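/- Let $p$ be a prime, let $k$ be a finite field of characteristic $p$, and let $G$ be a profinite group which is virtually pro-$p$ (that is, $G$ has an open pro-$p$ subgroup). Let $G_{\mathrm{reg}}$ be the set of $p$-regular elements of $G$, i.e. those whose profinite order is coprime to $p$, with the subspace topology, and let $m$ be the (finite) $p'$-part of the profinite order $|G|$. Let $k' = k(\omega)$, where $\omega$ is a primitive $m$-th root of unity, and let $\mathcal{G}_k = \mathrm{Gal}(k'/k)$. The group $G$ acts on $G_{\mathrm{reg}}$ by conjugation, and $\sigma \in \mathcal{G}_k$ acts on $G_{\mathrm{reg}}$ by $\sigma.g = g^{t_\sigma}$, where $t_\sigma \in (\mathbb{Z}/m\mathbb{Z})^\times$ is determined by $\sigma(\omega) = \omega^{t_\sigma}$. Let $K$ be a finite unramified extension of $\mathbb{Q}_p$ with residue field $k$ and let $F = K(\tilde\omega)$, where $\tilde\omega$ is a primitive $m$-th root of unity; the residue field of $F$ is identified with $k'$, compatibly with the identification of the residue field of $K$ with $k$. For an $m$-th root of unity $\xi \in k'$ let $\tilde\xi$ be the unique $m$-th root of unity in $F$ which reduces to $\xi$. Let $k[[G]] = \varprojlim_U k[G/U]$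 ($U$ running over the open normal subgroups of $G$) be the completed group algebra, and let $\mathcal{F}_0$ be the category of (Hausdorff) topological right $k[[G]]$-modules which are finite dimensional over $k$. Let $K_0(\mathcal{F}_0)$ be its Grothendieck group, generated by the classes $[A]$ of objects with the relations $[A] = [A'] + [A'']$ for the short exact sequences $0 \to A' \to A \to A'' \to 0$ in $\mathcal{F}_0$, and put $FK_0(\mathcal{F}_0) = F \otimes_{\mathbb{Z}} K_0(\mathcal{F}_0)$. For $A \in \mathcal{F}_0$ and $g \in G_{\mathrm{reg}}$ let $\xi_1, \dots, \xi_d \in k'$ be the eigenvalues, with multiplicity, of the action of $g$ on $A$ (where $d = \dim_k A$), and let $\varphi_A(g) = \sum_{i=1}^d \tilde\xi_i \in F$; the function $\varphi_A$ is the Brauer character of $A$. Let $C(G_{\mathrm{reg}};F)^{G\times\mathcal{G}_k}$ be the $F$-vector space of locally constant functions $G_{\mathrm{reg}} \to F$ which are invariant under $G \times \mathcal{G}_k$. Theorem. There is a well-defined $F$-linear map $$\varphi : FK_0(\mathcal{F}_0) \to C(G_{\mathrm{reg}};F)^{G\times\mathcal{G}_k}, \qquad \varphi(\lambda \otimes [A])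 = \lambda\,\varphi_A \quad (\lambda \in F,\ A \in \mathcal{F}_0),$$ and $\varphi$ is an isomorphism of $F$-vector spaces. -/

import Mathlib

open CategoryTheory TensorProduct
open scoped ModuleCat

noncomputable section

namespace BermanWitt

universe u v w

/-! ### Profinite groups and `p`-regular elements -/

section Groups

variable (p : ℕ) (G : Type v) [Group G] [TopologicalSpace G]

/-- A (profinite) group is pro-`p` if all its quotients by open normal subgroups are `p`-groups. -/
def IsProP : Prop :=
  ∀ U : OpenNormalSubgroup G, IsPGroup p (G ⧸ U.toSubgroup)

/-- A (profinite) group is virtually pro-`p` if it has an open pro-`p` subgroup. -/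
def IsVirtuallyProP : Prop :=
  ∃ H : OpenSubgroup G, IsProP p H.toSubgroup

/-- The `p'`-part of the order of a profinite group. The profinite order `|G|` is the least common
multiple of the indices of the open normal subgroups; since these subgroups are directed, its
`p'`-part, when finite, is the largest among the `p'`-parts of the indices. -/
def pPrimePart : ℕ :=
  ⨆ U : OpenNormalSubgroup G, ordCompl[p] U.toSubgroup.index

variable {G}

/-- An element is `p`-regular if its profinite order, which is the least common multiple of the
orders of its images in the quotients by open normal subgroups, is coprime to `p`. -/
def IsPRegular (g : G) : Prop :=
  ∀ U : OpenNormalSubgroup G, (orderOf (QuotientGroup.mk g : G ⧸ U.toSubgroup)).Coprime p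

variable (G)

/-- The set `G_reg` of `p`-regular elements, with the subspace topology. -/
abbrev Reg : Type v := {g : G // IsPRegular p g}

variable {p G}

theorem IsPRegular.pow_conj {g : G} (hg : IsPRegular p g) (x : G) (t : ℕ) :
    IsPRegular p (x * g ^ t * x⁻¹) := by
  intro U
  have h1 : (QuotientGroup.mk (x * g ^ t * x⁻¹) : G ⧸ U.toSubgroup) =
      MulAut.conj (QuotientGroup.mk x : G ⧸ U.toSubgroup)
        ((QuotientGroup.mk g : G ⧸ U.toSubgroup) ^ t) := by
    simp [MulAut.conj_apply]
  rw [h1, MulEquiv.orderOf_eq]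
  exact Nat.Coprime.coprime_dvd_left (orderOf_pow_dvd t) (hg U)

/-- The element `x g ^ t x⁻¹` of `G_reg`. -/
def Reg.powConj (x : G) (t : ℕ) (g : Reg p G) : Reg p G :=
  ⟨x * g.1 ^ t * x⁻¹, g.2.pow_conj x t⟩

end Groups

/-! ### Invariant locally constant functions -/

section Functions

variable (p : ℕ) (G : Type v) [Group G] [TopologicalSpace G]
variable (k k' : Type*) [Field k] [Field k'] [Algebra k k'] (F : Type*) [Field F]

/-- The space `C(G_reg; F)^(G × Gal(k'/k))`. Here `x ∈ G` acts on `G_reg` by conjugation, and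
`σ ∈ Gal(k'/k)` acts by `g ↦ g ^ t`, where `σ ζ = ζ ^ t` for all `m`-th roots of unity `ζ` in `k'`,
with `m` the `p'`-part of `|G|`. -/
def invariantFunctions : Submodule F (LocallyConstant (Reg p G) F) where
  carrier := {f | ∀ (x : G) (σ : k' ≃ₐ[k] k') (t : ℕ),
    (∀ ζ : k', ζ ^ pPrimePart p G = 1 → σ ζ = ζ ^ t) →
      ∀ g : Reg p G, f (Reg.powConj x t g) = f g}
  add_mem' := by
    intro a b ha hb x σ t h g
    simp [ha x σ t h g, hb x σ t h g]
  zero_mem' := by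
    intro x σ t h g
    simp
  smul_mem' := by
    intro c a ha x σ t h g
    simp [ha x σ t h g]

end Functions

/-! ### The completed group algebra -/

section Algebra

variable (k : Type u) [Field k] (G : Type v) [Group G] [TopologicalSpace G]

/-- The transition map `k[G/U] → k[G/V]` for `U ≤ V`. -/
def transition {U V : OpenNormalSubgroup G} (h : U ≤ V) :
    MonoidAlgebra k (G ⧸ U.toSubgroup) →ₐ[k] MonoidAlgebra k (G ⧸ V.toSubgroup) :=
  MonoidAlgebra.mapDomainAlgHom k k
    (QuotientGroup.map U.toSubgroup V.toSubgroup (MonoidHom.id G) h)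

/-- The completed group algebra `k[[G]]`: the inverse limit of the group algebras `k[G/U]` over the
open normal subgroups `U`, as a subalgebra of their product. -/
def completedGroupAlgebra :
    Subalgebra k (∀ U : OpenNormalSubgroup G, MonoidAlgebra k (G ⧸ U.toSubgroup)) where
  carrier := {x | ∀ (U V : OpenNormalSubgroup G) (h : U ≤ V), transition k G h (x U) = x V}
  mul_mem' := by
    intro a b ha hb U V h
    simp [ha U V h, hb U V h]
  add_mem' := by
    intro a b ha hb U V h
    simp [ha U V h, hb U V h]
  algebraMap_mem' := by
    intro r U V h
    simp only [Pi.algebraMap_apply, AlgHom.commutes]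

/-- The inverse limit topology on `k[[G]]`, each `k[G/U]` being discrete. -/
instance completedGroupAlgebra.topologicalSpace :
    TopologicalSpace (completedGroupAlgebra k G) :=
  TopologicalSpace.induced Subtype.val
    (@Pi.topologicalSpace (OpenNormalSubgroup G)
      (fun U => MonoidAlgebra k (G ⧸ U.toSubgroup)) (fun _ => ⊥))

variable {G} in
/-- The canonical image of a group element in `k[[G]]`. -/
def groupElement (g : G) : completedGroupAlgebra k G :=
  ⟨fun U => MonoidAlgebra.single (QuotientGroup.mk g : G ⧸ U.toSubgroup) 1, by
    intro U V h
    simp only [transition, MonoidAlgebra.mapDomainAlgHom_apply, MonoidAlgebra.mapDomain_single]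
    rfl⟩

/-- Right `k[[G]]`-modules. -/
abbrev RightModules : Type _ := ModuleCat.{max u v} (completedGroupAlgebra k G)ᵐᵒᵖ

/-- The category `𝓕₀` of topological right `k[[G]]`-modules of finite dimension over `k`, as a full
subcategory of the category of right `k[[G]]`-modules. The field `k` is finite, so that such a
module is a finite set and its (Hausdorff) topology is the discrete one; the condition is that the
action map is continuous. -/
def finiteDimTopModules : ObjectProperty (RightModules k G) := fun A =>
  Module.Finite k A ∧
    letI : TopologicalSpace A := ⊥
    ContinuousSMul (completedGroupAlgebra k G)ᵐᵒᵖ A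

end Algebra

/-! ### Grothendieck groups -/

section Grothendieck

variable {C : Type u} [Category.{v} C] [Abelian C] (P : ObjectProperty C)

/-- The relations `[M] = [M'] + [M'']` for the short exact sequences `0 → M' → M → M'' → 0` of `C`
with all terms in the full subcategory given by `P`. -/
def K0Relations : AddSubgroup (FreeAbelianGroup P.FullSubcategory) :=
  AddSubgroup.closure {z | ∃ (M' M M'' : P.FullSubcategory) (f : M'.obj ⟶ M.obj)
    (g : M.obj ⟶ M''.obj) (h : f ≫ g = 0), (ShortComplex.mk f g h).ShortExact ∧
      z = FreeAbelianGroup.of M - FreeAbelianGroup.of M' - FreeAbelianGroup.of M''}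

/-- The Grothendieck group of the full subcategory of the abelian category `C` given by `P`. -/
abbrev K0 : Type _ := FreeAbelianGroup P.FullSubcategory ⧸ K0Relations P

variable {P} in
/-- The class of an object in the Grothendieck group. -/
def K0.mk (M : P.FullSubcategory) : K0 P :=
  QuotientAddGroup.mk (FreeAbelianGroup.of M)

end Grothendieck

/-! ### Brauer characters -/

section BrauerCharacter

/-- Given a reduction map `red : O → k'`, the `m`-th root of unity `ξ̃` of `F` that comes from an
`m`-th root of unity of `O` reducing to `ξ` (and `0` if there is none). -/
def rootLift {O : Type*} [CommRing O] (F : Type*) [Field F] [Algebra O F]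
    {k' : Type*} [Field k'] (red : O →+* k') (m : ℕ) (ξ : k') : F :=
  open Classical in
  if h : ∃ z : O, z ^ m = 1 ∧ red z = ξ then algebraMap O F h.choose else 0

variable {k : Type u} [Field k] {G : Type v} [Group G] [TopologicalSpace G]

/-- The action `a ↦ a g` of `g ∈ G` on a right `k[[G]]`-module, as a `k`-linear endomorphism. -/
def actionEnd (A : RightModules k G) (g : G) : A →ₗ[k] A :=
  Algebra.lsmul k k A (MulOpposite.op (groupElement k g))

/-- The Brauer character of a finite-dimensional topological `k[[G]]`-module `A`: the sum of the
lifts `ξ̃` of the eigenvalues `ξ` in `k'`, with multiplicity, of the action of `g` on `A`. -/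
def brauerCharacter (p : ℕ) {O : Type*} [CommRing O] (F : Type*) [Field F] [Algebra O F]
    {k' : Type*} [Field k'] [Algebra k k'] (red : O →+* k')
    (A : (finiteDimTopModules k G).FullSubcategory) (g : Reg p G) : F :=
  haveI : Module.Finite k A.obj := A.property.1
  (((actionEnd A.obj g.1).charpoly.aroots k').map (rootLift F red (pPrimePart p G))).sum

end BrauerCharacter

end BermanWitt

end

open Polynomial

set_option linter.unusedSectionVars false


/-! Write `O` for the integral closure in `F`, `red` for its reduction map to `k'`, and `m` for the
`p'`-part of `|G|`. Continuity forces each object of the category to be a module over some finite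
`k[G/U]`, and a `p`-regular `g` acts on it with `g ^ m = 1`. Its eigenvalues are therefore `m`-th
roots of unity, which lift uniquely to `O` since `p ∤ m`. Characteristic polynomials are
multiplicative on short exact sequences, so Brauer characters are additive. They are Galois
invariant because `σ` permutes the roots of a polynomial over `k` (`brauerCharacter_powConj`).

Injectivity: simple objects generate `K₀`, so it is enough that their Brauer characters are linearly
independent (`linearIndependent_brauerFunction`). A relation is rescaled inside a valuation ring of
`F` lying over `ker red` so that its coefficients are integral and one of them is `1`. Reducing it
gives a relation between traces on `p`-regular elements. As `tr (T ^ |k|) = tr T` over the finite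
field `k`, the relation extends to all of `G`, hence to all of `k[[G]]`. The density theorem
supplies an element with nonzero trace on one simple module that kills the others, a contradiction.

Surjectivity needs no induction theorem, since `F` has characteristic zero. For `c` in `G/U` with `c
^ m = 1`, induce the characters of `⟨c⟩` to `G/U` over `O`, reduce them to `k'` and restrict scalars
to `k`. Fourier inversion on `⟨c⟩` combines the resulting Brauer characters into the function
counting the pairs `(σ, x)` with `x⁻¹ g ^ t_σ x = c` (`exists_brauerLinear_eq_sum_ite`). Averaging
an invariant `f` against these counts returns `f` times the nonzero integer `|Gal(k'/k)| · |G/U|`.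
-/

/-! ### Characteristic polynomials in exact sequences and of powers. -/

theorem Module.Basis.sumQuot_toMatrix {R V : Type*} [CommRing R] [AddCommGroup V] [Module R V]
    (W : Submodule R V) {m n : Type*} [Fintype m] [Fintype n] [DecidableEq m] [DecidableEq n]
    (bW : Module.Basis m R W) (bQ : Module.Basis n R (V ⧸ W)) (e : V →ₗ[R] V)
    (he : W ≤ W.comap e) :
    LinearMap.toMatrix (bW.sumQuot bQ) (bW.sumQuot bQ) e =
      Matrix.fromBlocks (LinearMap.toMatrix bW bW (e.restrict he))
        (Matrix.of fun i l => (bW.sumQuot bQ).repr (e (bW.sumQuot bQ (Sum.inr l))) (Sum.inl i)) 0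
        (LinearMap.toMatrix bQ bQ (W.mapQ W e he)) := by
  ext u v
  cases u with
  | inl i =>
    cases v with
    | inl k =>
      simp only [Module.Basis.sumQuot_inl, Matrix.fromBlocks_apply₁₁, LinearMap.toMatrix_apply]
      apply Module.Basis.sumQuot_repr_inl_of_mem
    | inr l => simp [LinearMap.toMatrix_apply, Matrix.fromBlocks_apply₁₂]
  | inr j =>
    cases v with
    | inl k =>
      suffices W.mkQ (e (bW k)) = 0 by simp [LinearMap.toMatrix_apply, this]
      rw [← LinearMap.mem_ker, Submodule.ker_mkQ]
      exact he (Submodule.coe_mem (bW k))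
    | inr l =>
      simp only [LinearMap.toMatrix_apply, Module.Basis.sumQuot_repr_inr, Matrix.fromBlocks_apply₂₂,
        ← Module.Basis.sumQuot_inr bW bQ l]
      rfl

theorem LinearMap.charpoly_eq_mul_mapQ {k V : Type*} [Field k] [AddCommGroup V] [Module k V]
    [Module.Finite k V] (W : Submodule k V) (e : V →ₗ[k] V) (he : W ≤ W.comap e) :
    e.charpoly = (e.restrict he).charpoly * (W.mapQ W e he).charpoly := by
  let bW := Module.Free.chooseBasis k W
  let bQ := Module.Free.chooseBasis k (V ⧸ W)
  rw [← LinearMap.charpoly_toMatrix e (bW.sumQuot bQ), Module.Basis.sumQuot_toMatrix W bW bQ e he,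
    Matrix.charpoly_fromBlocks_zero₂₁, LinearMap.charpoly_toMatrix, LinearMap.charpoly_toMatrix]

theorem LinearMap.charpoly_eq_mul_of_exact {k V V' V'' : Type*} [Field k]
    [AddCommGroup V] [Module k V] [Module.Finite k V] [AddCommGroup V'] [Module k V']
    [Module.Finite k V'] [AddCommGroup V''] [Module k V''] [Module.Finite k V'']
    (i : V' →ₗ[k] V) (q : V →ₗ[k] V'') (hi : Function.Injective i) (hq : Function.Surjective q)
    (hex : Function.Exact i q) (e' : V' →ₗ[k] V') (e : V →ₗ[k] V) (e'' : V'' →ₗ[k] V'')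
    (h1 : ∀ x, i (e' x) = e (i x)) (h2 : ∀ x, q (e x) = e'' (q x)) :
    e.charpoly = e'.charpoly * e''.charpoly := by
  have hW : LinearMap.ker q = LinearMap.range i := hex.linearMap_ker_eq
  have he : LinearMap.range i ≤ (LinearMap.range i).comap e := by
    rintro _ ⟨x, rfl⟩
    exact ⟨e' x, h1 x⟩
  have key := LinearMap.charpoly_eq_mul_mapQ (LinearMap.range i) e he
  have a1 : (e.restrict he).charpoly = e'.charpoly := by
    rw [← LinearEquiv.charpoly_conj (LinearEquiv.ofInjective i hi) e']
    congr 1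
    ext x
    obtain ⟨y, rfl⟩ := (LinearEquiv.ofInjective i hi).surjective x
    simp [LinearEquiv.conj_apply, h1]
  have a2 : ((LinearMap.range i).mapQ _ e he).charpoly = e''.charpoly := by
    let E : (V ⧸ LinearMap.range i) ≃ₗ[k] V'' :=
      (Submodule.quotEquivOfEq _ _ hW.symm).trans (q.quotKerEquivOfSurjective hq)
    have hE : ∀ x : V, E (Submodule.Quotient.mk x) = q x := fun x => by simp [E]
    rw [← LinearEquiv.charpoly_conj E]
    congr 1
    ext x
    obtain ⟨y, rfl⟩ := hq x
    have : E.symm (q y) = Submodule.Quotient.mk y := by rw [LinearEquiv.symm_apply_eq, hE]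
    simp [LinearEquiv.conj_apply, this, hE, h2]
  rw [key, a1, a2]

/-- An endomorphism killed by a split separable `X ^ m - 1` has eigenvalues whose powers are the
eigenvalues of its powers. -/
theorem LinearMap.exists_charpoly_pow_eq {k : Type*} [Field k] {m : ℕ} (hm : m ≠ 0)
    (hs : (X ^ m - 1 : k[X]).Splits) :
    ∀ (n : ℕ) {V : Type _} [AddCommGroup V]
    [Module k V] [Module.Finite k V] (T : Module.End k V) (_ : Module.finrank k V = n) (_ : T ^ m = 1),
    ∃ s : Multiset k, (∀ ξ ∈ s, ξ ^ m = 1) ∧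
      ∀ t : ℕ, (T ^ t).charpoly = (s.map fun ξ => X - C (ξ ^ t)).prod := by
  intro n
  induction n with
  | zero =>
    intro V _ _ _ T hV _
    refine ⟨0, by simp, fun t => ?_⟩
    have : (T ^ t).charpoly.natDegree = 0 := by rw [LinearMap.charpoly_natDegree, hV]
    simpa using (Polynomial.Monic.natDegree_eq_zero (LinearMap.charpoly_monic _)).1 this
  | succ n ih =>
    intro V _ _ _ T hV hT
    have hnt : Nontrivial V := Module.nontrivial_of_finrank_pos (R := k) (by omega)
    have hdvd : minpoly k T ∣ (X ^ m - 1 : k[X]) := minpoly.dvd _ _ (by simp [hT])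
    have hne : (X ^ m - 1 : k[X]) ≠ 0 := (monic_X_pow_sub_C 1 hm).ne_zero
    have hsp : (minpoly k T).Splits := hs.of_dvd hne hdvd
    obtain ⟨ξ, hξ⟩ := hsp.exists_eval_eq_zero
      (minpoly.degree_pos (Algebra.IsIntegral.isIntegral T)).ne'
    have hξm : ξ ^ m = 1 := by
      have := eval_eq_zero_of_dvd_of_eval_eq_zero hdvd hξ
      simpa [sub_eq_zero] using this
    obtain ⟨v, hv⟩ := (Module.End.hasEigenvalue_of_isRoot hξ).exists_hasEigenvector
    have hpow : ∀ t : ℕ, (T ^ t) v = ξ ^ t • v := fun t => hv.pow_apply t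
    -- The eigenline is stable under every power of `T`, so splitting it off and inducting on the
    -- quotient gives one multiset `s` valid for all `t` at once.
    let W : Submodule k V := Submodule.span k {v}
    have hW : ∀ t : ℕ, W ≤ W.comap (T ^ t) := by
      intro t
      rw [Submodule.span_le, Set.singleton_subset_iff]
      change (T ^ t) v ∈ W
      rw [hpow]
      exact W.smul_mem _ (Submodule.mem_span_singleton_self v)
    have hW1 : W ≤ W.comap T := by simpa using hW 1
    have hfr : Module.finrank k W = 1 := finrank_span_singleton hv.2
    have hq : ∀ t : ℕ, W.mapQ W (T ^ t) (hW t) = (W.mapQ W T hW1) ^ t := by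
      intro t
      have := Submodule.mapQ_pow (p := W) (f := T) hW1 t
      exact this
    obtain ⟨s, hs1, hs2⟩ := ih (W.mapQ W T hW1)
      (by have := W.finrank_quotient_add_finrank; omega) (by
        rw [← hq]
        ext x
        simp [hT])
    refine ⟨ξ ::ₘ s, ?_, fun t => ?_⟩
    · intro x hx
      rcases Multiset.mem_cons.1 hx with rfl | hx
      · exact hξm
      · exact hs1 x hx
    · rw [LinearMap.charpoly_eq_mul_mapQ W (T ^ t) (hW t), hq, hs2, Multiset.map_cons,
        Multiset.prod_cons]
      congr 1
      have : (T ^ t).restrict (hW t) = ξ ^ t • (1 : Module.End k W) := by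
        ext ⟨x, hx⟩
        obtain ⟨a, rfl⟩ := Submodule.mem_span_singleton.1 hx
        simp [LinearMap.restrict_apply, hpow, smul_comm a (ξ ^ t) v]
      rw [this]
      let b := Module.finBasisOfFinrankEq k W hfr
      rw [← LinearMap.charpoly_toMatrix _ b]
      simp [Matrix.charpoly, Matrix.charmatrix]
-- Characteristic polynomials under restriction of scalars.
-- The blocks lie in the image of a commutative ring, so the determinant of the block matrix is the
-- determinant of the blockwise determinant (`Matrix.det_det`), here applied to the characteristic
-- matrix. With `f` the regular representation of `k'` over `k`, this handles restriction of
-- scalars.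
theorem Matrix.charpoly_comp_map {R S m n : Type*} [CommRing R] [CommRing S] [Fintype m]
    [Fintype n] [DecidableEq m] [DecidableEq n] (f : S →+* Matrix n n R) (M : Matrix m m S)
    (s : Multiset S) (hs : M.charpoly = (s.map fun z => X - C z).prod) :
    ((M.map f).comp m m n n R).charpoly = (s.map fun z => (f z).charpoly).prod := by
  have h1 : ∀ z, f.polyToMatrix (X - C z) = (f z).charmatrix := by
    intro z
    ext i j : 2
    simp [RingHom.polyToMatrix, Matrix.charmatrix]
  have h2 : ((M.map f).comp m m n n R).charmatrix =
      ((M.charmatrix).map f.polyToMatrix).comp m m n n R[X] := by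
    ext ⟨i, i'⟩ ⟨j, j'⟩ : 2
    by_cases hij : i = j
    · subst hij
      by_cases h : i' = j' <;>
      simp [Matrix.diagonal, RingHom.polyToMatrix, h]
    · simp [RingHom.polyToMatrix, hij]
  let δ : S[X] →* R[X] := Matrix.detMonoidHom.comp (f.polyToMatrix : S[X] →* Matrix n n R[X])
  rw [Matrix.charpoly, h2, ← Matrix.det_det, ← Matrix.charpoly, hs]
  change δ _ = _
  rw [map_multiset_prod, Multiset.map_map]
  congr 1
  refine Multiset.map_congr rfl fun z _ => ?_
  change (f.polyToMatrix (X - C z)).det = _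
  rw [h1]
  rfl

/-- The matrix `Q = (σ (b i))` conjugates multiplication by `z` into the diagonal matrix of the
conjugates of `z`; it is invertible by Dedekind's independence of characters. Indexing the basis by
the Galois group makes `Q` square. -/
theorem Algebra.charpoly_leftMulMatrix_map_eq_prod {k L : Type*} [Field k] [Field L] [Algebra k L]
    [FiniteDimensional k L] [IsGalois k L] [Fintype (L ≃ₐ[k] L)] [DecidableEq (L ≃ₐ[k] L)]
    (b : Module.Basis (L ≃ₐ[k] L) k L) (z : L) :
    ((Algebra.leftMulMatrix b z).charpoly).map (algebraMap k L) =
      ∏ σ : L ≃ₐ[k] L, (X - C (σ z)) := by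
  let Q : Matrix (L ≃ₐ[k] L) (L ≃ₐ[k] L) L := Matrix.of fun σ i => σ (b i)
  let D : Matrix (L ≃ₐ[k] L) (L ≃ₐ[k] L) L := Matrix.diagonal fun σ => σ z
  have hQ : IsUnit Q := by
    rw [← Matrix.linearIndependent_rows_iff_isUnit]
    have li : LinearIndependent L (fun σ : L ≃ₐ[k] L => (σ : L → L)) := by
      have := (linearIndependent_monoidHom L L).comp
        (fun σ : L ≃ₐ[k] L => (((σ : L →ₐ[k] L) : L →+* L) : L →* L)) (by
          intro σ τ h
          ext x
          exact DFunLike.congr_fun h x)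
      exact this
    rw [Fintype.linearIndependent_iff] at li ⊢
    intro g hg
    refine li g ?_
    have hlin : (∑ σ : L ≃ₐ[k] L, g σ • (σ : L →ₐ[k] L).toLinearMap) = 0 := by
      refine b.ext fun i => ?_
      have := congrFun hg i
      simpa [Q] using this
    ext x
    have := LinearMap.congr_fun hlin x
    simpa using this
  have hcomm : Q * (Algebra.leftMulMatrix b z).map (algebraMap k L) = D * Q := by
    ext σ j
    rw [Matrix.diagonal_mul, Matrix.mul_apply]
    have h : z * b j = ∑ i, Algebra.leftMulMatrix b z i j • b i := by
      conv_lhs => rw [← b.sum_repr (z * b j)]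
      simp [Algebra.leftMulMatrix_eq_repr_mul]
    have h2 := congrArg σ h
    rw [map_mul, map_sum] at h2
    simp only [Q, Matrix.of_apply]
    rw [h2]
    refine Finset.sum_congr rfl fun i _ => ?_
    rw [map_smul, Algebra.smul_def, Matrix.map_apply, mul_comm]
  obtain ⟨u, hu⟩ := hQ
  rw [← Matrix.charpoly_map]
  have h3 : (Algebra.leftMulMatrix b z).map (algebraMap k L) = u⁻¹.val * D * u.val := by
    rw [mul_assoc, hu, ← hcomm, ← hu, ← mul_assoc, Units.inv_mul, one_mul]
  rw [h3, Matrix.coe_units_inv, Matrix.charpoly_units_conj']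
  simp [D, Matrix.charpoly_diagonal]

/-! ### Representations induced from one-dimensional characters. -/

section Monomial

variable {Γ R : Type*} [Group Γ] [CommRing R] (H : Subgroup Γ) (χ : H →* R)

open Classical in
/-- Extension of a character of a subgroup by zero. -/
noncomputable def MonoidHom.extendZero (y : Γ) : R := if h : y ∈ H then χ ⟨y, h⟩ else 0

theorem MonoidHom.extendZero_of_mem {y : Γ} (h : y ∈ H) : χ.extendZero H y = χ ⟨y, h⟩ := dif_pos h

theorem MonoidHom.extendZero_of_notMem {y : Γ} (h : y ∉ H) : χ.extendZero H y = 0 := dif_neg h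

theorem MonoidHom.extendZero_mul_of_mem {x y : Γ} (h : y ∈ H) :
    χ.extendZero H (x * y) = χ.extendZero H x * χ.extendZero H y := by
  by_cases hx : x ∈ H
  · rw [extendZero_of_mem H χ (H.mul_mem hx h), extendZero_of_mem H χ h, extendZero_of_mem H χ hx,
      ← map_mul]
    rfl
  · rw [extendZero_of_notMem H χ hx, zero_mul,
      extendZero_of_notMem H χ fun hxy => hx ((H.mul_mem_cancel_right h).1 hxy)]

/-- The matrix representation induced from a character of a subgroup. -/
noncomputable def MonoidHom.inducedMatrix [Fintype (Γ ⧸ H)] [DecidableEq (Γ ⧸ H)] :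
    Γ →* Matrix (Γ ⧸ H) (Γ ⧸ H) R where
  toFun g := Matrix.of fun i j => χ.extendZero H (i.out⁻¹ * g * j.out)
  map_one' := by
    ext i j
    by_cases h : i = j
    · subst h
      simp only [Matrix.of_apply, mul_one, inv_mul_cancel, Matrix.one_apply_eq,
        extendZero_of_mem H χ H.one_mem]
      exact map_one χ
    · rw [Matrix.one_apply_ne h, Matrix.of_apply, extendZero_of_notMem]
      intro hmem
      apply h
      rw [mul_one, ← QuotientGroup.eq] at hmem
      simpa using hmem
  map_mul' g g' := by
    ext i j
    -- The matrices are monomial: in column `j` of the matrix of `g'` only the row of the coset `g'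
    -- j` can be nonzero.
    rw [Matrix.mul_apply, Finset.sum_eq_single ((g' * j.out : Γ) : Γ ⧸ H)]
    · simp only [Matrix.of_apply]
      rw [← extendZero_mul_of_mem]
      · congr 1
        group
      · rw [mul_assoc, ← QuotientGroup.eq]
        simp
    · intro l _ hl
      simp only [Matrix.of_apply]
      rw [extendZero_of_notMem H χ (y := l.out⁻¹ * g' * j.out), mul_zero]
      intro hmem
      apply hl
      rw [mul_assoc, ← QuotientGroup.eq] at hmem
      simpa using hmem
    · simp

theorem MonoidHom.trace_inducedMatrix [Fintype (Γ ⧸ H)] [DecidableEq (Γ ⧸ H)] (g : Γ) :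
    (χ.inducedMatrix H g).trace = ∑ i : Γ ⧸ H, χ.extendZero H (i.out⁻¹ * g * i.out) := rfl

end Monomial

/-- Each coset contributes `|H|` equal terms. This turns the sum over representatives in an induced
character into a sum over the whole group. -/
theorem Subgroup.sum_quotient_out_conj {Γ M : Type*} [Group Γ] [Fintype Γ] [AddCommMonoid M]
    (H : Subgroup Γ) [Fintype (Γ ⧸ H)] (Y : Γ → M) (hY : ∀ x, ∀ h ∈ H, Y (x * h) = Y x) :
    Nat.card H • ∑ i : Γ ⧸ H, Y i.out = ∑ x : Γ, Y x := by
  classical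
  have := Fintype.ofFinite H
  rw [← Finset.sum_fiberwise (s := Finset.univ) (g := fun x : Γ => (x : Γ ⧸ H)), Finset.smul_sum]
  refine Finset.sum_congr rfl fun i _ => ?_
  rw [Finset.sum_congr rfl (g := fun _ => Y i.out), Finset.sum_const]
  · congr 1
    have hinj : Function.Injective fun h : H => i.out * (h : Γ) := fun a b h => by simpa using h
    rw [Nat.card_eq_fintype_card, Fintype.card, ← Finset.card_image_of_injective _ hinj]
    congr 1
    ext x
    simp only [Finset.mem_image, Finset.mem_univ, true_and, Finset.mem_filter]
    constructor
    · rintro ⟨h, rfl⟩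
      simp
    · intro hx
      refine ⟨⟨i.out⁻¹ * x, ?_⟩, by simp⟩
      rw [← QuotientGroup.eq]
      simp [hx]
  · intro x hx
    have hx : (x : Γ ⧸ H) = i := by simpa using hx
    have : i.out⁻¹ * x ∈ H := by
      rw [← QuotientGroup.eq]
      simp [hx]
    rw [← hY i.out _ this]
    simp

namespace BermanWitt

/-! ### The `p'`-part of the order and `p`-regular elements of a virtually pro-`p` group. -/

section Groups

variable {p : ℕ} [Fact p.Prime] {G : Type*} [Group G] [TopologicalSpace G] [IsTopologicalGroup G]
  [CompactSpace G] [TotallyDisconnectedSpace G]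

theorem exists_openNormalSubgroup_le {W : Set G} (hW : W ∈ nhds (1 : G)) :
    ∃ N : OpenNormalSubgroup G, (N : Set G) ⊆ W := by
  obtain ⟨V, hVW, hV, h1⟩ := mem_nhds_iff.1 hW
  obtain ⟨N, hN⟩ := ProfiniteGrp.exist_openNormalSubgroup_sub_open_nhds_of_one hV h1
  exact ⟨N, hN.trans hVW⟩

instance finite_quotient (U : OpenNormalSubgroup G) : Finite (G ⧸ U.toSubgroup) :=
  inferInstanceAs (Finite (G ⧸ U.toOpenSubgroup.toSubgroup))

theorem index_ne_zero (U : OpenNormalSubgroup G) : U.toSubgroup.index ≠ 0 :=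
  (Subgroup.finiteIndex_of_finite_quotient (H := U.toSubgroup)).index_ne_zero

/-- Any open normal `N` inside the open pro-`p` subgroup `H` works: `[N : N ∩ U] = [NU : U]` divides
`[HU : U] = [H : H ∩ U]`, a power of `p`. -/
theorem exists_relIndex_eq_pow (hG : IsVirtuallyProP p G) :
    ∃ N : OpenNormalSubgroup G, ∀ U : OpenNormalSubgroup G,
      ∃ a : ℕ, U.toSubgroup.relIndex N.toSubgroup = p ^ a := by
  obtain ⟨H, hH⟩ := hG
  obtain ⟨N, hN⟩ := exists_openNormalSubgroup_le H.mem_nhds_one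
  have hNH : N.toSubgroup ≤ H.toSubgroup := hN
  refine ⟨N, fun U => ?_⟩
  let U' : OpenNormalSubgroup H.toSubgroup :=
    { toSubgroup := U.toSubgroup.subgroupOf H.toSubgroup
      isOpen' := U.isOpen'.preimage continuous_subtype_val
      isNormal' := inferInstance }
  have h1 := hH U'
  have : Finite (H.toSubgroup ⧸ U'.toSubgroup) := by
    have := Subgroup.finiteIndex_of_finite_quotient (H := U.toSubgroup)
    change Finite (H.toSubgroup ⧸ U.toSubgroup.subgroupOf H.toSubgroup)
    infer_instance
  obtain ⟨b, hb⟩ := IsPGroup.iff_card.1 h1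
  have h2 : U.toSubgroup.relIndex H.toSubgroup = p ^ b := by
    rw [← hb]
    rfl
  have h3 : U.toSubgroup.relIndex N.toSubgroup ∣ U.toSubgroup.relIndex H.toSubgroup := by
    rw [← Subgroup.relIndex_sup_right, ← Subgroup.relIndex_sup_right (H := H.toSubgroup),
      ← Subgroup.relIndex_mul_relIndex _ (N.toSubgroup ⊔ U.toSubgroup) _ le_sup_right
        (sup_le_sup_right hNH _)]
    exact dvd_mul_right _ _
  rw [h2] at h3
  obtain ⟨a, -, ha⟩ := (Nat.dvd_prime_pow (Fact.out : p.Prime)).1 h3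
  exact ⟨a, ha⟩

theorem ordCompl_index_dvd {N : OpenNormalSubgroup G} (hN : ∀ U : OpenNormalSubgroup G,
      ∃ a : ℕ, U.toSubgroup.relIndex N.toSubgroup = p ^ a) (U : OpenNormalSubgroup G) :
    ordCompl[p] U.toSubgroup.index ∣ ordCompl[p] N.toSubgroup.index := by
  obtain ⟨a, ha⟩ := hN U
  have h1 : U.toSubgroup.index ∣ p ^ a * N.toSubgroup.index := by
    rw [← ha, ← Subgroup.inf_relIndex_right, Subgroup.relIndex_mul_index inf_le_right]
    exact Subgroup.index_dvd_of_le inf_le_left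
  have h2 := Nat.ordCompl_dvd_ordCompl_of_dvd h1 p
  rwa [Nat.ordCompl_mul, Nat.ordCompl_self_pow (Fact.out : p.Prime), one_mul] at h2

theorem exists_pPrimePart_eq (hG : IsVirtuallyProP p G) :
    ∃ N : OpenNormalSubgroup G, pPrimePart p G = ordCompl[p] N.toSubgroup.index ∧
      ∀ U : OpenNormalSubgroup G, ordCompl[p] U.toSubgroup.index ∣ pPrimePart p G := by
  obtain ⟨N, hN⟩ := exists_relIndex_eq_pow hG
  have hle := ordCompl_index_dvd hN
  have hpos : 0 < ordCompl[p] N.toSubgroup.index := Nat.ordCompl_pos p (index_ne_zero N)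
  have hm : pPrimePart p G = ordCompl[p] N.toSubgroup.index := by
    have : Nonempty (OpenNormalSubgroup G) := ⟨N⟩
    refine le_antisymm (ciSup_le fun U => Nat.le_of_dvd hpos (hle U)) ?_
    -- A supremum in `ℕ` is meaningful only for a bounded family; divisibility by the value at `N`
    -- provides the bound.
    refine le_ciSup (f := fun U : OpenNormalSubgroup G => ordCompl[p] U.toSubgroup.index) ?_ N
    exact ⟨_, by rintro _ ⟨U, rfl⟩; exact Nat.le_of_dvd hpos (hle U)⟩
  exact ⟨N, hm, fun U => hm ▸ hle U⟩

theorem ordCompl_index_dvd_pPrimePart (hG : IsVirtuallyProP p G) (U : OpenNormalSubgroup G) :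
    ordCompl[p] U.toSubgroup.index ∣ pPrimePart p G :=
  (exists_pPrimePart_eq hG).choose_spec.2 U

theorem pPrimePart_pos (hG : IsVirtuallyProP p G) : 0 < pPrimePart p G := by
  obtain ⟨N, hN, -⟩ := exists_pPrimePart_eq hG
  rw [hN]
  exact Nat.ordCompl_pos p (index_ne_zero N)

theorem coprime_pPrimePart (hG : IsVirtuallyProP p G) : p.Coprime (pPrimePart p G) := by
  obtain ⟨N, hN, -⟩ := exists_pPrimePart_eq hG
  rw [hN]
  exact Nat.coprime_ordCompl Fact.out (index_ne_zero N)

theorem orderOf_dvd_pow_mul (hG : IsVirtuallyProP p G) (U : OpenNormalSubgroup G)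
    (x : G ⧸ U.toSubgroup) : ∃ a : ℕ, orderOf x ∣ p ^ a * pPrimePart p G := by
  refine ⟨U.toSubgroup.index.factorization p, ?_⟩
  refine (orderOf_dvd_natCard x).trans ?_
  change U.toSubgroup.index ∣ _
  conv_lhs => rw [← Nat.ordProj_mul_ordCompl_eq_self U.toSubgroup.index p]
  exact Nat.mul_dvd_mul_left _ (ordCompl_index_dvd_pPrimePart hG U)

theorem orderOf_coprime_iff (hG : IsVirtuallyProP p G) (U : OpenNormalSubgroup G)
    (x : G ⧸ U.toSubgroup) : (orderOf x).Coprime p ↔ x ^ pPrimePart p G = 1 := by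
  rw [← orderOf_dvd_iff_pow_eq_one]
  constructor
  · intro h
    obtain ⟨a, ha⟩ := orderOf_dvd_pow_mul hG U x
    exact (h.pow_right a).dvd_of_dvd_mul_left ha
  · intro h
    exact ((coprime_pPrimePart hG).symm).coprime_dvd_left h

/-- In this form the condition is visibly closed, which makes `G_reg` compact. -/
theorem isPRegular_iff (hG : IsVirtuallyProP p G) (g : G) :
    IsPRegular p g ↔ ∀ U : OpenNormalSubgroup G, g ^ pPrimePart p G ∈ U := by
  refine forall_congr' fun U => ?_
  rw [orderOf_coprime_iff hG, ← QuotientGroup.mk_pow, QuotientGroup.eq_one_iff]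
  rfl

theorem isClosed_openNormalSubgroup (U : OpenNormalSubgroup G) : IsClosed (U : Set G) :=
  U.toOpenSubgroup.isClosed

theorem compactSpace_reg (hG : IsVirtuallyProP p G) : CompactSpace (Reg p G) := by
  refine isCompact_iff_compactSpace (s := {g : G | IsPRegular p g}).1 ?_
  apply IsClosed.isCompact
  simp only [isPRegular_iff hG, Set.ofPred_forall]
  exact isClosed_iInter fun U => (isClosed_openNormalSubgroup U).preimage (continuous_pow _)

/-- The `p`-regular part of an element is approximated by its powers. -/
theorem exists_reg_mk_eq_pow (hG : IsVirtuallyProP p G) {q : ℕ} (hpq : p ∣ q)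
    (hq : q ≡ 1 [MOD pPrimePart p G]) (g : G) (U : OpenNormalSubgroup G) :
    ∃ (h : Reg p G) (n : ℕ), (h.1 : G ⧸ U.toSubgroup) = (g : G ⧸ U.toSubgroup) ^ q ^ n := by
  -- Modulo `p ^ a * m`, the number `q ^ n` is eventually `0` on the `p`-part and always `1` on the
  -- `m`-part, so `g ^ q ^ n` is eventually constant in each finite quotient.
  have key : ∀ V : OpenNormalSubgroup G, ∃ a : ℕ, ∀ n, a ≤ n →
      (g : G ⧸ V.toSubgroup) ^ q ^ n = (g : G ⧸ V.toSubgroup) ^ q ^ a := by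
    intro V
    obtain ⟨a, ha⟩ := orderOf_dvd_pow_mul hG V (g : G ⧸ V.toSubgroup)
    refine ⟨a, fun n hn => ?_⟩
    rw [pow_eq_pow_iff_modEq]
    refine Nat.ModEq.of_dvd ha ?_
    refine (Nat.modEq_and_modEq_iff_modEq_mul ((coprime_pPrimePart hG).pow_left a)).1 ⟨?_, ?_⟩
    · have h1 : p ^ a ∣ q ^ n := (pow_dvd_pow p hn).trans (pow_dvd_pow_of_dvd hpq n)
      have h2 : p ^ a ∣ q ^ a := pow_dvd_pow_of_dvd hpq a
      exact ((Nat.modEq_zero_iff_dvd).2 h1).trans ((Nat.modEq_zero_iff_dvd).2 h2).symm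
    · have h1 : ∀ i, q ^ i ≡ 1 [MOD pPrimePart p G] := fun i => by simpa using hq.pow i
      exact (h1 n).trans (h1 a).symm
  choose a ha using key
  -- A cluster point serves as the limit: in each quotient it has the eventual value.
  obtain ⟨h, hh⟩ := exists_clusterPt_of_compactSpace (Filter.map (fun n => g ^ q ^ n) Filter.atTop)
  have hV : ∀ V : OpenNormalSubgroup G,
      (h : G ⧸ V.toSubgroup) = (g : G ⧸ V.toSubgroup) ^ q ^ (a V) := by
    intro V
    have hopen : (fun x : G => h⁻¹ * x) ⁻¹' (V : Set G) ∈ nhds h :=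
      (V.isOpen'.preimage (continuous_const_mul _)).mem_nhds (by simp)
    have hfreq : ∃ᶠ n in Filter.atTop, g ^ q ^ n ∈ (fun x : G => h⁻¹ * x) ⁻¹' (V : Set G) := 
      mapClusterPt_iff_frequently.1 hh _ hopen
    obtain ⟨n, hn, hn2⟩ := (hfreq.and_eventually (Filter.eventually_ge_atTop (a V))).exists
    rw [← ha V n hn2, ← QuotientGroup.mk_pow]
    exact QuotientGroup.eq.2 hn
  refine ⟨⟨h, fun V => ?_⟩, a U, hV U⟩
  rw [orderOf_coprime_iff hG, hV, ← pow_mul, ← orderOf_dvd_iff_pow_eq_one]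
  obtain ⟨b, hb⟩ := orderOf_dvd_pow_mul hG V (g : G ⧸ V.toSubgroup)
  -- Enlarging the exponent to at least `b` makes `q ^ n` divisible by `p ^ b`, the `p`-part
  -- bounding the order of `g` in the quotient.
  have h1 : (g : G ⧸ V.toSubgroup) ^ q ^ (a V) = (g : G ⧸ V.toSubgroup) ^ q ^ (max (a V) b) :=
    (ha V _ (le_max_left _ _)).symm
  rw [orderOf_dvd_iff_pow_eq_one, pow_mul, h1, ← pow_mul, ← orderOf_dvd_iff_pow_eq_one]
  refine hb.trans (Nat.mul_dvd_mul_right ?_ _)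
  exact (pow_dvd_pow p (le_max_right _ _)).trans (pow_dvd_pow_of_dvd hpq _)

/-- The `p`-regular part of any lift of `x` still maps to `x`, because `q = p ^ φ(m)` satisfies `q ^
n ≡ 1` modulo `m`. -/
theorem exists_reg_mk_eq (hG : IsVirtuallyProP p G) (U : OpenNormalSubgroup G)
    (x : G ⧸ U.toSubgroup) (hx : x ^ pPrimePart p G = 1) :
    ∃ h : Reg p G, (h.1 : G ⧸ U.toSubgroup) = x := by
  obtain ⟨g, rfl⟩ := QuotientGroup.mk_surjective x
  have hm := pPrimePart_pos hG
  have hq : p ^ (pPrimePart p G).totient ≡ 1 [MOD pPrimePart p G] :=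
    Nat.ModEq.pow_totient (coprime_pPrimePart hG)
  obtain ⟨h, n, hn⟩ := exists_reg_mk_eq_pow hG
    (dvd_pow_self p (Nat.totient_pos.2 hm).ne') hq g U
  refine ⟨h, hn.trans ?_⟩
  conv_rhs => rw [← pow_one (g : G ⧸ U.toSubgroup)]
  rw [pow_eq_pow_iff_modEq]
  refine Nat.ModEq.of_dvd (orderOf_dvd_iff_pow_eq_one.2 hx) ?_
  simpa using hq.pow n

theorem Reg.mk_pow_eq_one (hG : IsVirtuallyProP p G) (U : OpenNormalSubgroup G) (g : Reg p G) :
    (g.1 : G ⧸ U.toSubgroup) ^ pPrimePart p G = 1 :=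
  (orderOf_coprime_iff hG U _).1 (g.2 U)

/-- Compactness of `G_reg` makes local constancy uniform; the subgroups found locally are
intersected. -/
theorem exists_openNormalSubgroup_factor (hG : IsVirtuallyProP p G) {X : Type*}
    (f : LocallyConstant (Reg p G) X) : ∃ U : OpenNormalSubgroup G, ∀ g h : Reg p G,
      (g.1 : G ⧸ U.toSubgroup) = h.1 → f g = f h := by
  have := compactSpace_reg (G := G) hG
  suffices h : ∃ U : OpenNormalSubgroup G, ∀ g ∈ (Set.univ : Set (Reg p G)), ∀ h : Reg p G,
      (g.1 : G ⧸ U.toSubgroup) = h.1 → f g = f h by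
    obtain ⟨U, hU⟩ := h
    exact ⟨U, fun g h => hU g trivial h⟩
  refine isCompact_univ.induction_on (p := fun S : Set (Reg p G) => ∃ U : OpenNormalSubgroup G,
    ∀ g ∈ S, ∀ h : Reg p G, (g.1 : G ⧸ U.toSubgroup) = h.1 → f g = f h) ?_ ?_ ?_ ?_
  · obtain ⟨N, -⟩ := exists_openNormalSubgroup_le (G := G) Filter.univ_mem
    exact ⟨N, by simp⟩
  · rintro S T hST ⟨U, hU⟩
    exact ⟨U, fun g hg => hU g (hST hg)⟩
  · rintro S T ⟨U, hU⟩ ⟨V, hV⟩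
    refine ⟨U ⊓ V, fun g hg h hgh => ?_⟩
    have hmem := QuotientGroup.eq.1 hgh
    rcases hg with hg | hg
    · exact hU g hg h (QuotientGroup.eq.2 hmem.1)
    · exact hV g hg h (QuotientGroup.eq.2 hmem.2)
  · intro x _
    have hopen : IsOpen {y | f y = f x} := f.isLocallyConstant.isOpen_fiber (f x)
    obtain ⟨W, hW, hWeq⟩ := isOpen_induced_iff.1 hopen
    have hx : x.1 ∈ W := by
      have : x ∈ Subtype.val ⁻¹' W := hWeq ▸ rfl
      exact this
    obtain ⟨U, hU⟩ := exists_openNormalSubgroup_le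
      (W := (fun y => x.1 * y) ⁻¹' W) ((hW.preimage (continuous_const_mul _)).mem_nhds (by simpa))
    have hstep : ∀ y : Reg p G, (x.1)⁻¹ * y.1 ∈ U → f y = f x := by
      intro y hy
      have : y ∈ Subtype.val ⁻¹' W := by simpa using hU hy
      rwa [hWeq] at this
    refine ⟨{y | (x.1)⁻¹ * y.1 ∈ U}, ?_, U, fun g hg h hgh => ?_⟩
    · refine mem_nhdsWithin_of_mem_nhds (IsOpen.mem_nhds ?_ ?_)
      · exact (U.isOpen'.preimage (continuous_const_mul _)).preimage continuous_subtype_val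
      · simp
    · rw [hstep g hg, hstep h]
      have : (x.1)⁻¹ * g.1 * ((g.1)⁻¹ * h.1) ∈ U := U.mul_mem' hg (QuotientGroup.eq.1 hgh)
      simpa [mul_assoc] using this

end Groups

end BermanWitt

namespace BermanWitt

universe u v

/-! ### Lifting roots of unity along the reduction map. -/

section RootLift

variable {O : Type*} [CommRing O] [IsDomain O] {F : Type*} [Field F] [Algebra O F]
  {k' : Type*} [Field k'] (red : O →+* k') {m : ℕ} {ω : O}

/-- Reduction carries roots of the cyclotomic polynomial to roots, and these detect primitivity
where `m` is invertible. -/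
theorem isPrimitiveRoot_red (hω : IsPrimitiveRoot ω m) (hm : (m : k') ≠ 0) :
    IsPrimitiveRoot (red ω) m := by
  have hm0 : 0 < m := Nat.pos_of_ne_zero (by rintro rfl; simp at hm)
  have : NeZero (m : k') := ⟨hm⟩
  rw [← isRoot_cyclotomic_iff, ← map_cyclotomic m red]
  exact (hω.isRoot_cyclotomic hm0).map

theorem red_injOn (hω : IsPrimitiveRoot ω m) (hm : (m : k') ≠ 0) {z z' : O} (hz : z ^ m = 1)
    (hz' : z' ^ m = 1) (h : red z = red z') : z = z' := by
  have hm0 : m ≠ 0 := by rintro rfl; simp at hm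
  have : NeZero m := ⟨hm0⟩
  obtain ⟨i, hi, rfl⟩ := hω.eq_pow_of_pow_eq_one hz
  obtain ⟨j, hj, rfl⟩ := hω.eq_pow_of_pow_eq_one hz'
  rw [map_pow, map_pow] at h
  rw [(isPrimitiveRoot_red red hω hm).pow_inj hi hj h]

theorem rootLift_red (hω : IsPrimitiveRoot ω m) (hm : (m : k') ≠ 0) {z : O} (hz : z ^ m = 1) :
    rootLift F red m (red z) = algebraMap O F z := by
  have h : ∃ z' : O, z' ^ m = 1 ∧ red z' = red z := ⟨z, hz, rfl⟩
  rw [rootLift, dif_pos h,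
    red_injOn red hω hm h.choose_spec.1 hz h.choose_spec.2]

theorem exists_red_eq (hω : IsPrimitiveRoot ω m) (hm : (m : k') ≠ 0) {ξ : k'} (hξ : ξ ^ m = 1) :
    ∃ z : O, z ^ m = 1 ∧ red z = ξ := by
  have hm0 : m ≠ 0 := by rintro rfl; simp at hm
  have : NeZero m := ⟨hm0⟩
  obtain ⟨i, -, rfl⟩ := (isPrimitiveRoot_red red hω hm).eq_pow_of_pow_eq_one hξ
  exact ⟨ω ^ i, by rw [← pow_mul, mul_comm, pow_mul, hω.pow_eq_one, one_pow], map_pow _ _ _⟩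

end RootLift

/-! ### Modules over `k[[G]]` factor through finite quotients. -/

section Modules

variable {k : Type u} [Field k] {G : Type v} [Group G] [TopologicalSpace G]

theorem groupElement_one : groupElement k (1 : G) = 1 := rfl

theorem groupElement_mul (g h : G) :
    groupElement k (g * h) = groupElement k g * groupElement k h := by
  refine Subtype.ext (funext fun U => ?_)
  simp [groupElement]

theorem actionEnd_apply (A : RightModules k G) (g : G) (a : A) :
    actionEnd A g a = MulOpposite.op (groupElement k g) • a := rfl

theorem actionEnd_mul (A : RightModules k G) (g h : G) :
    actionEnd A (g * h) = actionEnd A h * actionEnd A g := by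
  ext a
  simp [actionEnd_apply, groupElement_mul, mul_smul]

theorem actionEnd_one (A : RightModules k G) : actionEnd A (1 : G) = 1 := by
  ext a
  simp [actionEnd_apply, groupElement_one]

theorem actionEnd_pow (A : RightModules k G) (g : G) (t : ℕ) :
    actionEnd A (g ^ t) = actionEnd A g ^ t := by
  induction t with
  | zero => simp [actionEnd_one]
  | succ n ih => rw [pow_succ, actionEnd_mul, ih, pow_succ']

/-- The action of `k[[G]]` on a module factors through `k[G/U]`. -/
def ActsThrough (A : RightModules k G) (U : OpenNormalSubgroup G) : Prop :=
  ∀ x : completedGroupAlgebra k G, x.1 U = 0 → ∀ a : A, MulOpposite.op x • a = 0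

theorem completedGroupAlgebra_apply_eq_zero {x : completedGroupAlgebra k G}
    {U V : OpenNormalSubgroup G} (h : V ≤ U) (hx : x.1 V = 0) : x.1 U = 0 := by
  rw [← x.2 V U h, hx, map_zero]

theorem ActsThrough.mono {A : RightModules k G} {U V : OpenNormalSubgroup G} (hA : ActsThrough A U)
    (h : V ≤ U) : ActsThrough A V :=
  fun x hx a => hA x (completedGroupAlgebra_apply_eq_zero h hx) a

theorem ActsThrough.smul_eq {A : RightModules k G} {U : OpenNormalSubgroup G}
    (hA : ActsThrough A U) {x y : completedGroupAlgebra k G} (h : x.1 U = y.1 U) (a : A) :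
    MulOpposite.op x • a = MulOpposite.op y • a := by
  rw [← sub_eq_zero, ← sub_smul, ← MulOpposite.op_sub]
  exact hA _ (by simp [h]) a

theorem ActsThrough.actionEnd_eq {A : RightModules k G} {U : OpenNormalSubgroup G}
    (hA : ActsThrough A U) {g h : G} (hgh : (g : G ⧸ U.toSubgroup) = h) :
    actionEnd A g = actionEnd A h := by
  ext a
  exact hA.smul_eq (by simp [groupElement, hgh]) a

instance : Nonempty (OpenNormalSubgroup G) :=
  ⟨{ (⊤ : OpenSubgroup G) with isNormal' := inferInstanceAs (⊤ : Subgroup G).Normal }⟩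

theorem exists_openNormalSubgroup_le_finset {ι : Type*} (s : Finset ι)
    (U : ι → OpenNormalSubgroup G) : ∃ V : OpenNormalSubgroup G, ∀ i ∈ s, V ≤ U i := by
  classical
  induction s using Finset.induction_on with
  | empty => exact ⟨Classical.arbitrary _, by simp⟩
  | insert a s _ ih =>
    obtain ⟨V, hV⟩ := ih
    refine ⟨V ⊓ U a, fun i hi => ?_⟩
    rcases Finset.mem_insert.1 hi with rfl | hi
    · exact inf_le_right
    · exact inf_le_left.trans (hV i hi)

/-- A basic neighbourhood of `0` constrains finitely many components, and all of them vanish once a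
component at a common smaller subgroup does. -/
theorem exists_apply_eq_zero_imp_mem {W : Set (completedGroupAlgebra k G)} (hW : IsOpen W)
    (h0 : 0 ∈ W) : ∃ U : OpenNormalSubgroup G, ∀ x : completedGroupAlgebra k G,
      x.1 U = 0 → x ∈ W := by
  let _ : ∀ U : OpenNormalSubgroup G, TopologicalSpace (MonoidAlgebra k (G ⧸ U.toSubgroup)) :=
    fun _ => ⊥
  obtain ⟨S, hS, rfl⟩ := isOpen_induced_iff.1 hW
  obtain ⟨I, w, hw, hIw⟩ := isOpen_pi_iff.1 hS _ h0
  obtain ⟨V, hV⟩ := exists_openNormalSubgroup_le_finset I id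
  refine ⟨V, fun x hx => hIw fun U hU => ?_⟩
  rw [completedGroupAlgebra_apply_eq_zero (U := U) (hV U hU) hx]
  exact (hw U hU).2

/-- The annihilator of each vector is open and there are only finitely many vectors. -/
theorem exists_actsThrough [Finite k] (A : (finiteDimTopModules k G).FullSubcategory) :
    ∃ U, ActsThrough A.obj U := by
  obtain ⟨hfin, hcont⟩ := A.property
  let _ : TopologicalSpace A.obj := ⊥
  have : DiscreteTopology A.obj := ⟨rfl⟩
  have hA : Finite A.obj := Module.finite_of_finite k
  have := Fintype.ofFinite A.obj
  have key : ∀ a : A.obj, ∃ U : OpenNormalSubgroup G, ∀ x : completedGroupAlgebra k G,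
      x.1 U = 0 → MulOpposite.op x • a = 0 := by
    intro a
    have hc : Continuous fun x : completedGroupAlgebra k G => MulOpposite.op x • a :=
      (continuous_smul (M := (completedGroupAlgebra k G)ᵐᵒᵖ) (X := A.obj)).comp
        (MulOpposite.continuous_op.prodMk continuous_const)
    obtain ⟨U, hU⟩ := exists_apply_eq_zero_imp_mem
      ((isOpen_discrete {(0 : A.obj)}).preimage hc) (by simp)
    exact ⟨U, fun x hx => hU x hx⟩
  choose U hU using key
  obtain ⟨V, hV⟩ := exists_openNormalSubgroup_le_finset Finset.univ U
  exact ⟨V, fun x hx a =>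
    hU a x (completedGroupAlgebra_apply_eq_zero (hV a (Finset.mem_univ _)) hx)⟩

/-- An action factoring through `k[G/U]` is the linear extension of the action of `G`. -/
theorem ActsThrough.smul_eq_sum {A : RightModules k G} {U : OpenNormalSubgroup G}
    (hA : ActsThrough A U) (x : completedGroupAlgebra k G) (a : A) :
    MulOpposite.op x • a =
      ∑ γ ∈ (x.1 U).coeff.support, (x.1 U).coeff γ • actionEnd A γ.out a := by
  have h := hA.smul_eq (x := x)
    (y := ∑ γ ∈ (x.1 U).coeff.support, (x.1 U).coeff γ • groupElement k γ.out) ?_ a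
  · rw [h, Finset.op_sum, Finset.sum_smul]
    refine Finset.sum_congr rfl fun γ _ => ?_
    rw [actionEnd_apply, MulOpposite.op_smul, smul_assoc]
  · refine MonoidAlgebra.ext (Finsupp.ext fun γ' => ?_)
    simp only [groupElement, AddSubmonoidClass.coe_finsetSum, Finset.sum_apply]
    conv_lhs => rw [← Finsupp.sum_single (x.1 U).coeff, Finsupp.sum, Finsupp.finsetSum_apply]
    simp [MonoidAlgebra.coeff_sum]

end Modules

end BermanWitt

namespace BermanWitt

universe u v

/-! ### Brauer characters: invariance, additivity and reduction to traces. -/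

section BrauerCharacter

variable {p : ℕ} [Fact p.Prime] {G : Type v} [Group G] [TopologicalSpace G] [IsTopologicalGroup G]
  [CompactSpace G] [TotallyDisconnectedSpace G] {k : Type u} [Field k] [Finite k]
  {k' : Type*} [Field k'] [Algebra k k'] {O : Type*} [CommRing O] [IsDomain O]
  {F : Type*} [Field F] [Algebra O F] (red : O →+* k') {ω : O}

theorem moduleFinite_obj (A : (finiteDimTopModules k G).FullSubcategory) :
    Module.Finite k A.obj := A.property.1

theorem actionEnd_pow_pPrimePart (hG : IsVirtuallyProP p G)
    (A : (finiteDimTopModules k G).FullSubcategory) (g : Reg p G) :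
    actionEnd A.obj g.1 ^ pPrimePart p G = 1 := by
  obtain ⟨U, hU⟩ := exists_actsThrough A
  rw [← actionEnd_pow, ← actionEnd_one]
  exact hU.actionEnd_eq (by simpa using Reg.mk_pow_eq_one hG U g)

/-- The lifted eigenvalues of a `p`-regular element on a module. -/
theorem exists_charpoly_eq_prod (hG : IsVirtuallyProP p G)
    (hω : IsPrimitiveRoot ω (pPrimePart p G)) (hm : (pPrimePart p G : k') ≠ 0)
    (A : (finiteDimTopModules k G).FullSubcategory) [Module.Finite k A.obj] (g : Reg p G) :
    ∃ s : Multiset O, (∀ z ∈ s, z ^ pPrimePart p G = 1) ∧ ∀ t : ℕ,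
      (actionEnd A.obj g.1 ^ t).charpoly.map (algebraMap k k') =
        (s.map fun z => X - C (red z ^ t)).prod := by
  obtain ⟨s, hs, hst⟩ := LinearMap.exists_charpoly_pow_eq (pPrimePart_pos hG).ne'
    (X_pow_sub_one_splits (isPrimitiveRoot_red red hω hm)) _
    ((actionEnd A.obj g.1).baseChange k') rfl (by
      rw [← LinearMap.baseChange_pow, actionEnd_pow_pPrimePart hG A g, LinearMap.baseChange_one])
  -- The implication inside the existential makes the lift a total function; the value `0` away from
  -- roots of unity is never used.
  have hlift : ∀ ξ : k', ∃ z : O, ξ ^ pPrimePart p G = 1 → z ^ pPrimePart p G = 1 ∧ red z = ξ := by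
    intro ξ
    by_cases h : ξ ^ pPrimePart p G = 1
    · obtain ⟨z, hz⟩ := exists_red_eq red hω hm h
      exact ⟨z, fun _ => hz⟩
    · exact ⟨0, fun h' => absurd h' h⟩
  choose l hl using hlift
  refine ⟨s.map l, ?_, fun t => ?_⟩
  · intro z hz
    obtain ⟨ξ, hξ, rfl⟩ := Multiset.mem_map.1 hz
    exact (hl ξ (hs ξ hξ)).1
  · rw [← LinearMap.charpoly_baseChange, LinearMap.baseChange_pow, hst, Multiset.map_map]
    congr 1
    refine Multiset.map_congr rfl fun ξ hξ => ?_
    simp [(hl ξ (hs ξ hξ)).2]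

theorem sum_rootLift_aroots {m : ℕ} (hω : IsPrimitiveRoot ω m) (hm : (m : k') ≠ 0) {P : k[X]}
    {s : Multiset O} (hs : ∀ z ∈ s, z ^ m = 1)
    (hP : P.map (algebraMap k k') = (s.map fun z => X - C (red z)).prod) :
    ((P.aroots k').map (rootLift F red m)).sum = (s.map (algebraMap O F)).sum := by
  have h : P.aroots k' = s.map red := by
    have h2 : (s.map fun z => X - C (red z)) = (s.map red).map fun a => X - C a := by
      rw [Multiset.map_map]; rfl
    rw [aroots, hP, h2, roots_multiset_prod_X_sub_C]
  rw [h, Multiset.map_map]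
  congr 1
  exact Multiset.map_congr rfl fun z hz => rootLift_red red hω hm (hs z hz)

theorem charpoly_actionEnd_powConj (A : (finiteDimTopModules k G).FullSubcategory)
    [Module.Finite k A.obj] (x : G) (t : ℕ) (g : Reg p G) :
    (actionEnd A.obj (Reg.powConj x t g).1).charpoly = (actionEnd A.obj g.1 ^ t).charpoly := by
  let e : A.obj ≃ₗ[k] A.obj := LinearEquiv.ofLinearMap (actionEnd A.obj x⁻¹) (actionEnd A.obj x)
    (by rw [← Module.End.mul_eq_comp, ← actionEnd_mul, mul_inv_cancel, actionEnd_one]; rfl)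
    (by rw [← Module.End.mul_eq_comp, ← actionEnd_mul, inv_mul_cancel, actionEnd_one]; rfl)
  rw [← actionEnd_pow, ← LinearEquiv.charpoly_conj e (actionEnd A.obj (g.1 ^ t))]
  congr 1
  simp only [Reg.powConj, actionEnd_mul]
  rfl

theorem brauerCharacter_eq_sum (hω : IsPrimitiveRoot ω (pPrimePart p G))
    (hm : (pPrimePart p G : k') ≠ 0) (A : (finiteDimTopModules k G).FullSubcategory)
    [Module.Finite k A.obj] (g : Reg p G) {s : Multiset O} (hs : ∀ z ∈ s, z ^ pPrimePart p G = 1)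
    (hst : (actionEnd A.obj g.1).charpoly.map (algebraMap k k') =
        (s.map fun z => X - C (red z)).prod) :
    brauerCharacter p F red A g = (s.map (algebraMap O F)).sum :=
  sum_rootLift_aroots (F := F) (k := k) red hω hm hs hst

/-- The characteristic polynomial of `g` has coefficients in `k`, so `σ` permutes its roots; as `σ`
raises them to the power `t`, the elements `g ^ t` and `g` have the same eigenvalues. -/
theorem brauerCharacter_powConj (hG : IsVirtuallyProP p G)
    (hω : IsPrimitiveRoot ω (pPrimePart p G)) (hm : (pPrimePart p G : k') ≠ 0)
    (A : (finiteDimTopModules k G).FullSubcategory) (x : G) (σ : k' ≃ₐ[k] k') (t : ℕ)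
    (ht : ∀ ζ : k', ζ ^ pPrimePart p G = 1 → σ ζ = ζ ^ t) (g : Reg p G) :
    brauerCharacter p F red A (Reg.powConj x t g) = brauerCharacter p F red A g := by
  have := moduleFinite_obj A
  obtain ⟨s, hs, hst⟩ := exists_charpoly_eq_prod red hG hω hm A g
  have h1 := hst 1
  simp only [pow_one] at h1
  rw [brauerCharacter_eq_sum (F := F) red hω hm A g hs h1]
  refine sum_rootLift_aroots (F := F) (k := k) red hω hm hs ?_
  rw [charpoly_actionEnd_powConj, hst]
  have h2 := congrArg (Polynomial.map (σ : k' →+* k')) h1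
  rw [Polynomial.map_map, Polynomial.map_multiset_prod, Multiset.map_map] at h2
  have h3 : (σ : k' →+* k').comp (algebraMap k k') = algebraMap k k' :=
    RingHom.ext fun a => σ.commutes a
  rw [h3, h1] at h2
  rw [h2]
  congr 1
  refine Multiset.map_congr rfl fun z hz => ?_
  have : σ (red z) = red z ^ t := ht _ (by rw [← map_pow, hs z hz, map_one])
  simp [this]

/-- This is how a relation between Brauer characters over `F` is reduced to a relation between
traces. -/
theorem exists_algebraMap_eq_brauerCharacter (hG : IsVirtuallyProP p G)
    (hω : IsPrimitiveRoot ω (pPrimePart p G)) (hm : (pPrimePart p G : k') ≠ 0)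
    (A : (finiteDimTopModules k G).FullSubcategory) (g : Reg p G) :
    ∃ b : O, algebraMap O F b = brauerCharacter p F red A g ∧
      red b = algebraMap k k' (LinearMap.trace k A.obj (actionEnd A.obj g.1)) := by
  have := moduleFinite_obj A
  obtain ⟨s, hs, hst⟩ := exists_charpoly_eq_prod red hG hω hm A g
  have h1 := hst 1
  simp only [pow_one] at h1
  refine ⟨s.sum, ?_, ?_⟩
  · rw [brauerCharacter_eq_sum (F := F) red hω hm A g hs h1, map_multiset_sum]
  · have h2 : (actionEnd A.obj g.1).charpoly.map (algebraMap k k') =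
        ((s.map red).map fun z => X - C z).prod := by rw [h1, Multiset.map_map]; rfl
    rw [← LinearMap.charpoly_baseChange] at h2
    rw [← LinearMap.trace_baseChange, Module.End.trace_eq_sum_roots_charpoly_of_splits, h2,
      roots_multiset_prod_X_sub_C, map_multiset_sum]
    rw [h2]
    exact Polynomial.Splits.multisetProd (by simp +contextual [Polynomial.Splits.X_sub_C])

theorem brauerCharacter_eq_add (A' A A'' : (finiteDimTopModules k G).FullSubcategory)
    (i : A'.obj →ₗ[(completedGroupAlgebra k G)ᵐᵒᵖ] A.obj)
    (q : A.obj →ₗ[(completedGroupAlgebra k G)ᵐᵒᵖ] A''.obj) (hi : Function.Injective i)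
    (hq : Function.Surjective q) (hex : Function.Exact i q) (g : Reg p G) :
    brauerCharacter p F red A g =
      brauerCharacter p F red A' g + brauerCharacter p F red A'' g := by
  have := moduleFinite_obj A
  have := moduleFinite_obj A'
  have := moduleFinite_obj A''
  have h := LinearMap.charpoly_eq_mul_of_exact (i.restrictScalars k) (q.restrictScalars k) hi hq hex
    (actionEnd A'.obj g.1) (actionEnd A.obj g.1) (actionEnd A''.obj g.1)
    (fun x => by simp [actionEnd_apply]) (fun x => by simp [actionEnd_apply])
  rw [brauerCharacter, h, aroots_mul, Multiset.map_add, Multiset.sum_add]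
  · rfl
  · exact mul_ne_zero (LinearMap.charpoly_monic _).ne_zero (LinearMap.charpoly_monic _).ne_zero

theorem isLocallyConstant_brauerCharacter (A : (finiteDimTopModules k G).FullSubcategory) :
    IsLocallyConstant fun g : Reg p G => brauerCharacter p F red A g := by
  obtain ⟨U, hU⟩ := exists_actsThrough A
  rw [IsLocallyConstant.iff_exists_open]
  intro g
  refine ⟨{h | (g.1)⁻¹ * h.1 ∈ U},
    (U.isOpen'.preimage (continuous_const_mul _)).preimage continuous_subtype_val, by simp, ?_⟩
  intro h hh
  simp only [brauerCharacter]
  rw [hU.actionEnd_eq (QuotientGroup.eq.2 hh)]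

/-- The Brauer character as an invariant locally constant function. -/
noncomputable def brauerFunction (hG : IsVirtuallyProP p G) (hω : IsPrimitiveRoot ω (pPrimePart p G))
    (hm : (pPrimePart p G : k') ≠ 0) (A : (finiteDimTopModules k G).FullSubcategory) :
    invariantFunctions p G k k' F :=
  ⟨⟨fun g => brauerCharacter p F red A g, isLocallyConstant_brauerCharacter red A⟩,
    fun x σ t ht g => brauerCharacter_powConj red hG hω hm A x σ t ht g⟩

/-- The map from the Grothendieck group to invariant functions given by Brauer characters. -/
noncomputable def brauerHom (hG : IsVirtuallyProP p G) (hω : IsPrimitiveRoot ω (pPrimePart p G))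
    (hm : (pPrimePart p G : k') ≠ 0) :
    K0 (finiteDimTopModules k G) →+ invariantFunctions p G k k' F :=
  QuotientAddGroup.lift _ (FreeAbelianGroup.lift (brauerFunction (F := F) red hG hω hm)) (by
    rw [K0Relations, AddSubgroup.closure_le]
    rintro _ ⟨M', M, M'', f, g, h, hS, rfl⟩
    have hadd : brauerFunction (F := F) red hG hω hm M = brauerFunction red hG hω hm M' +
        brauerFunction red hG hω hm M'' := by
      refine Subtype.ext (LocallyConstant.ext fun x => ?_)
      exact brauerCharacter_eq_add red M' M M'' f.hom g.hom hS.moduleCat_injective_f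
        hS.moduleCat_surjective_g ((ShortComplex.ShortExact.moduleCat_exact_iff_function_exact _).1 hS.exact) x
    change FreeAbelianGroup.lift _ _ = 0
    simp [hadd])

/-- The `F`-linear extension of `brauerHom`. -/
noncomputable def brauerLinear (hG : IsVirtuallyProP p G)
    (hω : IsPrimitiveRoot ω (pPrimePart p G)) (hm : (pPrimePart p G : k') ≠ 0) :
    F ⊗[ℤ] K0 (finiteDimTopModules k G) →ₗ[F] invariantFunctions p G k k' F :=
  (brauerHom (F := F) red hG hω hm).toIntLinearMap.liftBaseChange F

theorem brauerLinear_tmul_mk (hG : IsVirtuallyProP p G)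
    (hω : IsPrimitiveRoot ω (pPrimePart p G)) (hm : (pPrimePart p G : k') ≠ 0) (c : F)
    (A : (finiteDimTopModules k G).FullSubcategory) :
    brauerLinear red hG hω hm (c ⊗ₜ[ℤ] K0.mk A) = c • brauerFunction red hG hω hm A := by
  rw [brauerLinear, LinearMap.liftBaseChange_tmul]
  congr 1
  change FreeAbelianGroup.lift _ (FreeAbelianGroup.of A) = _
  simp

end BrauerCharacter

end BermanWitt

/-! ### Separating simple modules by traces. -/

section Density

/-- If `ℓ v = 1`, the rank-one map `x ↦ ℓ x • d • v` has `k`-trace `Tr_{D/k} d`, and the trace form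
of an extension of finite fields is surjective. -/
theorem exists_linearMap_trace_ne_zero (k D S : Type*) [Field k] [Field D] [Algebra k D]
    [Finite k] [Finite D] [AddCommGroup S] [Module k S] [Module D S] [IsScalarTower k D S]
    [Finite S] [Nontrivial S] :
    ∃ u : S →ₗ[D] S, LinearMap.trace k S (u.restrictScalars k) ≠ 0 := by
  have : Module.Finite k D := Module.Finite.of_finite
  have : Module.Finite k S := Module.Finite.of_finite
  obtain ⟨v, hv⟩ := exists_ne (0 : S)
  obtain ⟨ℓ, hℓ⟩ := (LinearMap.toSpanSingleton D S v).exists_leftInverse_of_injective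
    (LinearMap.ker_toSpanSingleton D hv)
  have hℓv : ℓ v = 1 := by simpa using LinearMap.congr_fun hℓ 1
  obtain ⟨d, hd⟩ := Algebra.trace_surjective k D 1
  refine ⟨(LinearMap.toSpanSingleton D S (d • v)).comp ℓ, ?_⟩
  have h1 := LinearMap.trace_comp_comm' (ℓ.restrictScalars k)
    ((LinearMap.toSpanSingleton D S (d • v)).restrictScalars k)
  have h2 : (ℓ.restrictScalars k) ∘ₗ ((LinearMap.toSpanSingleton D S (d • v)).restrictScalars k) =
      Algebra.lmul k D d := by
    ext x
    simp [hℓv, mul_comm]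
  rw [h2, ← Algebra.trace_apply, hd] at h1
  have h3 : ((LinearMap.toSpanSingleton D S (d • v)).comp ℓ).restrictScalars k =
    ((LinearMap.toSpanSingleton D S (d • v)).restrictScalars k) ∘ₗ (ℓ.restrictScalars k) := rfl
  rw [h3, h1]
  exact one_ne_zero

/-- By Schur and Wedderburn the finite ring `End_R S` is a field, over which `S` is a vector space.
-/
theorem IsSimpleModule.exists_end_trace_ne_zero (k R S : Type*) [Field k] [Finite k] [Ring R]
    [Algebra k R] [AddCommGroup S] [Module R S] [Module k S] [IsScalarTower k R S] [Finite S]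
    [IsSimpleModule R S] :
    ∃ u : S →ₗ[k] S, LinearMap.trace k S u ≠ 0 ∧ ∀ (d : Module.End R S) (s : S), u (d s) = d (u s) := by
  classical
  have : SMulCommClass R k S := IsScalarTower.to_smulCommClass'
  have : Finite (Module.End R S) := Finite.of_injective _ DFunLike.coe_injective
  have := IsSimpleModule.nontrivial R S
  let _ : Field (Module.End R S) := littleWedderburn _
  obtain ⟨u, hu⟩ := exists_linearMap_trace_ne_zero k (Module.End R S) S
  exact ⟨u.restrictScalars k, hu, fun d s => u.map_smul d s⟩

/-- There are no nonzero maps between distinct factors, so the endomorphism of `∏ S j` equal to `u`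
on `S i` and `0` elsewhere commutes with all `R`-endomorphisms. Jacobson density, on this finite
module, realizes it by an element of `R`. -/
theorem IsSimpleModule.exists_trace_ne_zero (k : Type*) {R ι : Type*} [Field k] [Finite k] [Ring R]
    [Algebra k R] [Fintype ι] [DecidableEq ι] (S : ι → Type*) [∀ i, AddCommGroup (S i)]
    [∀ i, Module R (S i)] [∀ i, Module k (S i)] [∀ i, IsScalarTower k R (S i)] [∀ i, Finite (S i)]
    [∀ i, IsSimpleModule R (S i)] (hS : ∀ i j, i ≠ j → IsEmpty (S i ≃ₗ[R] S j)) (i : ι) :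
    ∃ x : R, LinearMap.trace k (S i) (Algebra.lsmul k k (S i) x) ≠ 0 ∧
      ∀ j, j ≠ i → ∀ s : S j, x • s = 0 := by
  obtain ⟨u, hu, hcomm⟩ := IsSimpleModule.exists_end_trace_ne_zero k R (S i)
  have hzero : ∀ (φ : Module.End R (∀ j, S j)) (a b : ι), a ≠ b → ∀ s : S a,
      φ (Pi.single a s) b = 0 := by
    intro φ a b hab s
    let ψ : S a →ₗ[R] S b := LinearMap.proj b ∘ₗ φ ∘ₗ LinearMap.single R S a
    rcases LinearMap.bijective_or_eq_zero ψ with h | h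
    · exact ((hS a b hab).false (LinearEquiv.ofBijective ψ h)).elim
    · exact LinearMap.congr_fun h s
  have hdec : ∀ (φ : Module.End R (∀ j, S j)) (m : ∀ j, S j) (b : ι),
      φ m b = φ (Pi.single b (m b)) b := by
    intro φ m b
    conv_lhs => rw [← Finset.univ_sum_single m]
    rw [map_sum, Finset.sum_apply, Finset.sum_eq_single b]
    · intro a _ hab
      exact hzero φ a b hab _
    · simp
  let f : Module.End (Module.End R (∀ j, S j)) (∀ j, S j) :=
    { toFun := fun m => Pi.single i (u (m i))
      map_add' := fun m m' => by simp [Pi.single_add]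
      map_smul' := fun φ m => by
        let d : Module.End R (S i) := LinearMap.proj i ∘ₗ φ ∘ₗ LinearMap.single R S i
        funext b
        change (Pi.single i (u (φ m i)) : ∀ j, S j) b = φ (Pi.single i (u (m i))) b
        by_cases hb : b = i
        · subst hb
          rw [Pi.single_eq_same, hdec φ m b]
          exact hcomm d (m b)
        · rw [Pi.single_eq_of_ne hb, hzero φ i b (Ne.symm hb)] }
  have hfin : Fintype (∀ j, S j) := Fintype.ofFinite _
  obtain ⟨x, hx⟩ := jacobson_density f Finset.univ
  refine ⟨x, ?_, fun j hj s => ?_⟩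
  · convert hu
    ext s
    have := congrFun (hx (Pi.single i s) (Finset.mem_univ _)) i
    simpa [f] using this.symm
  · have := congrFun (hx (Pi.single j s) (Finset.mem_univ _)) j
    simpa [f, hj, Pi.single_eq_of_ne (Ne.symm hj)] using this.symm

end Density

namespace BermanWitt

universe u v

/-! ### Simple objects generate the Grothendieck group. -/

section SimpleModules

variable {p : ℕ} [Fact p.Prime] {G : Type v} [Group G] [TopologicalSpace G] [IsTopologicalGroup G]
  [CompactSpace G] [TotallyDisconnectedSpace G] {k : Type u} [Field k] [Finite k]

theorem finiteDimTopModules_of_actsThrough (B : RightModules k G) [Finite B]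
    {U : OpenNormalSubgroup G} (hU : ActsThrough B U) : finiteDimTopModules k G B := by
  refine ⟨Module.Finite.of_finite, ?_⟩
  let _ : TopologicalSpace B := ⊥
  have : DiscreteTopology B := ⟨rfl⟩
  refine ⟨IsLocallyConstant.continuous ?_⟩
  rw [IsLocallyConstant.iff_exists_open]
  rintro ⟨r, b⟩
  let _ : ∀ U : OpenNormalSubgroup G, TopologicalSpace (MonoidAlgebra k (G ⧸ U.toSubgroup)) :=
    fun _ => ⊥
  have hd : DiscreteTopology (MonoidAlgebra k (G ⧸ U.toSubgroup)) := ⟨rfl⟩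
  have hc : Continuous fun x : (completedGroupAlgebra k G)ᵐᵒᵖ => x.unop.1 U :=
    ((continuous_apply U).comp continuous_induced_dom).comp MulOpposite.continuous_unop
  refine ⟨((fun x : (completedGroupAlgebra k G)ᵐᵒᵖ => x.unop.1 U) ⁻¹' {r.unop.1 U}) ×ˢ {b},
    ((isOpen_discrete _).preimage hc).prod (isOpen_discrete _), by simp, ?_⟩
  rintro ⟨r', b'⟩ ⟨h1, h2⟩
  obtain rfl : b' = b := h2
  exact hU.smul_eq h1 b'

theorem finite_obj (A : (finiteDimTopModules k G).FullSubcategory) : Finite A.obj :=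
  have := moduleFinite_obj A
  Module.finite_of_finite k

/-- A submodule as an object. -/
noncomputable def subObj (A : (finiteDimTopModules k G).FullSubcategory)
    (N : Submodule (completedGroupAlgebra k G)ᵐᵒᵖ A.obj) :
    (finiteDimTopModules k G).FullSubcategory :=
  ⟨ModuleCat.of _ N, by
    obtain ⟨U, hU⟩ := exists_actsThrough A
    have := finite_obj A
    have : Finite (ModuleCat.of (completedGroupAlgebra k G)ᵐᵒᵖ N) := inferInstanceAs (Finite N)
    exact finiteDimTopModules_of_actsThrough _ (U := U) fun x hx a => Subtype.ext (hU x hx a.1)⟩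

/-- A quotient module as an object. -/
noncomputable def quotObj (A : (finiteDimTopModules k G).FullSubcategory)
    (N : Submodule (completedGroupAlgebra k G)ᵐᵒᵖ A.obj) :
    (finiteDimTopModules k G).FullSubcategory :=
  ⟨ModuleCat.of _ (A.obj ⧸ N), by
    obtain ⟨U, hU⟩ := exists_actsThrough A
    have := finite_obj A
    have : Finite (ModuleCat.of (completedGroupAlgebra k G)ᵐᵒᵖ (A.obj ⧸ N)) :=
      Finite.of_surjective _ N.mkQ_surjective
    refine finiteDimTopModules_of_actsThrough _ (U := U) fun x hx a => ?_
    obtain ⟨b, rfl⟩ := N.mkQ_surjective a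
    change MulOpposite.op x • N.mkQ b = 0
    rw [← map_smul, hU x hx b, map_zero]⟩

theorem K0.mk_eq_add {A' A A'' : (finiteDimTopModules k G).FullSubcategory}
    (i : A'.obj →ₗ[(completedGroupAlgebra k G)ᵐᵒᵖ] A.obj)
    (q : A.obj →ₗ[(completedGroupAlgebra k G)ᵐᵒᵖ] A''.obj) (hi : Function.Injective i)
    (hq : Function.Surjective q) (hex : Function.Exact i q) :
    K0.mk A = K0.mk A' + K0.mk A'' := by
  have h0 : ModuleCat.ofHom i ≫ ModuleCat.ofHom q = 0 := by
    ext x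
    exact hex.apply_apply_eq_zero x
  have hS : (ShortComplex.mk (ModuleCat.ofHom i) (ModuleCat.ofHom q) h0).ShortExact :=
    { exact := (ShortComplex.ShortExact.moduleCat_exact_iff_function_exact _).2 hex
      mono_f := (ModuleCat.mono_iff_injective _).2 hi
      epi_g := (ModuleCat.epi_iff_surjective _).2 hq }
  have hmem : FreeAbelianGroup.of A - FreeAbelianGroup.of A' - FreeAbelianGroup.of A'' ∈
      K0Relations (finiteDimTopModules k G) :=
    AddSubgroup.subset_closure ⟨A', A, A'', _, _, h0, hS, rfl⟩
  have := (QuotientAddGroup.eq_zero_iff _).2 hmem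
  rw [QuotientAddGroup.mk_sub, QuotientAddGroup.mk_sub] at this
  rw [sub_sub, sub_eq_zero] at this
  exact this

/-- For a zero module the identity maps `A → A → A` form a short exact sequence, so `[A] = [A] +
[A]`. -/
theorem K0.mk_eq_zero {A : (finiteDimTopModules k G).FullSubcategory} [Subsingleton A.obj] :
    K0.mk A = 0 := by
  have := K0.mk_eq_add (A := A) (A' := A) (A'' := A) LinearMap.id LinearMap.id
    Function.injective_id Function.surjective_id fun x =>
      ⟨fun _ => ⟨x, rfl⟩, fun _ => Subsingleton.elim _ _⟩
  simpa using this

theorem K0.mk_eq_of_equiv {A B : (finiteDimTopModules k G).FullSubcategory}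
    (e : A.obj ≃ₗ[(completedGroupAlgebra k G)ᵐᵒᵖ] B.obj) : K0.mk A = K0.mk B := by
  let Z := subObj A ⊥
  have : Subsingleton Z.obj := inferInstanceAs (Subsingleton (⊥ : Submodule _ A.obj))
  have h := K0.mk_eq_add (A' := Z) (A := A) (A'' := B) (Submodule.subtype ⊥) e.toLinearMap
    Subtype.val_injective e.surjective fun x => by
      constructor
      · intro hx
        exact ⟨⟨x, e.map_eq_zero_iff.1 hx⟩, rfl⟩
      · rintro ⟨⟨y, hy⟩, rfl⟩
        obtain rfl := hy
        exact map_zero _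
  rw [h, K0.mk_eq_zero, zero_add]

variable (G k) in
/-- The simple objects. -/
noncomputable def SimpleObj : Type _ :=
  {A : (finiteDimTopModules k G).FullSubcategory //
    IsSimpleModule (completedGroupAlgebra k G)ᵐᵒᵖ A.obj}

variable (G k) in
/-- Isomorphism of simple objects. -/
noncomputable def simpleSetoid : Setoid (SimpleObj G k) where
  r A B := Nonempty (A.1.obj ≃ₗ[(completedGroupAlgebra k G)ᵐᵒᵖ] B.1.obj)
  iseqv := ⟨fun _ => ⟨LinearEquiv.refl _ _⟩, fun ⟨e⟩ => ⟨e.symm⟩, fun ⟨e⟩ ⟨f⟩ => ⟨e.trans f⟩⟩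

variable (G k) in
/-- Isomorphism classes of simple objects. -/
abbrev SimpleClass : Type _ := Quotient (simpleSetoid G k)

/-- A representative of an isomorphism class of simple objects. -/
noncomputable def SimpleClass.rep (s : SimpleClass G k) : (finiteDimTopModules k G).FullSubcategory :=
  (Quotient.out s).1

instance (s : SimpleClass G k) :
    IsSimpleModule (completedGroupAlgebra k G)ᵐᵒᵖ s.rep.obj := (Quotient.out s).2

theorem SimpleClass.isEmpty_equiv {s t : SimpleClass G k} (h : s ≠ t) :
    IsEmpty (s.rep.obj ≃ₗ[(completedGroupAlgebra k G)ᵐᵒᵖ] t.rep.obj) := by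
  refine ⟨fun e => h ?_⟩
  rw [← Quotient.out_eq s, ← Quotient.out_eq t]
  exact Quotient.sound ⟨e⟩

/-- Dévissage: a nonzero non-simple module has a proper nonzero submodule, and both it and the
quotient have fewer elements. -/
theorem K0.mk_mem_closure_simple : ∀ (n : ℕ) (A : (finiteDimTopModules k G).FullSubcategory),
    Nat.card A.obj = n →
    K0.mk A ∈ AddSubgroup.closure (Set.range fun s : SimpleClass G k => K0.mk s.rep) := by
  intro n
  induction n using Nat.strong_induction_on with
  | _ n ih =>
    intro A hA
    have := finite_obj A
    by_cases hs : Subsingleton A.obj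
    · rw [K0.mk_eq_zero]
      exact zero_mem _
    rw [not_subsingleton_iff_nontrivial] at hs
    by_cases hsim : IsSimpleModule (completedGroupAlgebra k G)ᵐᵒᵖ A.obj
    · obtain ⟨e⟩ : Nonempty (A.obj ≃ₗ[(completedGroupAlgebra k G)ᵐᵒᵖ]
          (SimpleClass.rep (Quotient.mk (simpleSetoid G k) ⟨A, hsim⟩)).obj) :=
        (Quotient.exact (Quotient.out_eq (Quotient.mk (simpleSetoid G k) ⟨A, hsim⟩))).map
          LinearEquiv.symm
      rw [K0.mk_eq_of_equiv e]
      exact AddSubgroup.subset_closure ⟨_, rfl⟩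
    · obtain ⟨N, hN0, hN1⟩ : ∃ N : Submodule (completedGroupAlgebra k G)ᵐᵒᵖ A.obj,
          N ≠ ⊥ ∧ N ≠ ⊤ := by
        by_contra! hcon
        refine hsim ((isSimpleModule_iff _ _).2 ⟨fun N => ?_⟩)
        by_cases h : N = ⊥
        · exact Or.inl h
        · exact Or.inr (hcon N h)
      have hcard := Submodule.card_eq_card_quotient_mul_card N
      have h1 : 1 < Nat.card N := by
        have := (Submodule.nontrivial_iff_ne_bot).2 hN0
        exact Finite.one_lt_card
      have h2 : 1 < Nat.card (A.obj ⧸ N) := by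
        have := Submodule.Quotient.nontrivial_iff.2 hN1
        have : Finite (A.obj ⧸ N) := Finite.of_surjective _ N.mkQ_surjective
        exact Finite.one_lt_card
      rw [K0.mk_eq_add (A' := subObj A N) (A := A) (A'' := quotObj A N) N.subtype N.mkQ
        Subtype.val_injective N.mkQ_surjective (LinearMap.exact_subtype_mkQ N)]
      refine add_mem (ih (Nat.card N) ?_ _ rfl) (ih (Nat.card (A.obj ⧸ N)) ?_ _ rfl) <;> nlinarith

theorem K0.closure_simple_eq_top :
    AddSubgroup.closure (Set.range fun s : SimpleClass G k => K0.mk s.rep) = ⊤ := by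
  rw [eq_top_iff]
  rintro x -
  obtain ⟨y, rfl⟩ := QuotientAddGroup.mk_surjective x
  induction y using FreeAbelianGroup.induction_on with
  | zero => exact zero_mem _
  | of A => exact K0.mk_mem_closure_simple _ A rfl
  | neg A h => exact neg_mem h
  | add a b ha hb => exact add_mem ha hb

end SimpleModules

end BermanWitt

/-! ### Linear independence of simple Brauer characters, and injectivity. -/

/-- With `q = |k|`, one has `tr (T ^ q) = (tr T) ^ q`, and `a ^ q = a` in `k`. Traces thus see only
the `p`-regular part of a group element. -/
theorem LinearMap.trace_pow_card_pow {k V : Type*} [Field k] [Finite k] [AddCommGroup V]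
    [Module k V] [Module.Finite k V] (T : Module.End k V) (n : ℕ) :
    LinearMap.trace k V (T ^ Nat.card k ^ n) = LinearMap.trace k V T := by
  have := Fintype.ofFinite k
  induction n with
  | zero => simp
  | succ n ih =>
    rw [← ih, pow_succ, pow_mul, Nat.card_eq_fintype_card]
    let b := Module.finBasis k V
    rw [LinearMap.trace_eq_matrix_trace k b, LinearMap.trace_eq_matrix_trace k b,
      ← LinearMap.toMatrix_pow, FiniteField.trace_pow_card, FiniteField.pow_card]

namespace BermanWitt

universe u v

section Injectivity

variable {p : ℕ} [Fact p.Prime] {G : Type v} [Group G] [TopologicalSpace G] [IsTopologicalGroup G]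
  [CompactSpace G] [TotallyDisconnectedSpace G] {k : Type u} [Field k] [Finite k] [CharP k p]

theorem exists_card_pow_modEq (hG : IsVirtuallyProP p G) (k : Type*) [Field k] [Finite k]
    [CharP k p] : ∃ r : ℕ, p ∣ Nat.card k ^ r ∧ Nat.card k ^ r ≡ 1 [MOD pPrimePart p G] := by
  have := Fintype.ofFinite k
  obtain ⟨n, -, hn⟩ := FiniteField.card k p
  rw [Nat.card_eq_fintype_card, hn]
  have hm := pPrimePart_pos hG
  refine ⟨(pPrimePart p G).totient, ?_,
    Nat.ModEq.pow_totient ((coprime_pPrimePart hG).pow_left n)⟩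
  rw [← pow_mul]
  exact dvd_pow_self p (mul_ne_zero n.pos.ne' (Nat.totient_pos.2 hm).ne')

/-- A linear relation between traces on `p`-regular elements holds on the whole group algebra. -/
theorem sum_trace_eq_zero (hG : IsVirtuallyProP p G) {ι κ : Type*} [Field κ] (e : k →+* κ)
    (T : Finset ι) (S : ι → (finiteDimTopModules k G).FullSubcategory) (a : ι → κ)
    (h : ∀ g : Reg p G, ∑ i ∈ T, a i * e (LinearMap.trace k (S i).obj (actionEnd (S i).obj g.1)) = 0)
    (x : (completedGroupAlgebra k G)ᵐᵒᵖ) :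
    ∑ i ∈ T, a i * e (LinearMap.trace k (S i).obj (Algebra.lsmul k k (S i).obj x)) = 0 := by
  have hfin := fun i => moduleFinite_obj (S i)
  choose U hU using fun i => exists_actsThrough (S i)
  obtain ⟨V, hV⟩ := exists_openNormalSubgroup_le_finset T U
  have hSV : ∀ i ∈ T, ActsThrough (S i).obj V := fun i hi => (hU i).mono (hV i hi)
  have hgrp : ∀ g : G,
      ∑ i ∈ T, a i * e (LinearMap.trace k (S i).obj (actionEnd (S i).obj g)) = 0 := by
    intro g
    obtain ⟨r, hr1, hr2⟩ := exists_card_pow_modEq hG k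
    -- Taking `q` to be a power of `|k|` makes `y` act as `g` raised to a power of `|k|`, so `g` and
    -- `y` have equal traces.
    obtain ⟨y, n, hy⟩ := exists_reg_mk_eq_pow hG hr1 hr2 g V
    rw [← h y]
    refine Finset.sum_congr rfl fun i hi => ?_
    have h1 : actionEnd (S i).obj y.1 = actionEnd (S i).obj g ^ Nat.card k ^ (r * n) := by
      rw [← actionEnd_pow, pow_mul]
      exact (hSV i hi).actionEnd_eq hy
    rw [h1, LinearMap.trace_pow_card_pow]
  have hlin : ∀ i ∈ T, Algebra.lsmul k k (S i).obj x =
      ∑ γ ∈ (x.unop.1 V).coeff.support, (x.unop.1 V).coeff γ • actionEnd (S i).obj γ.out := by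
    intro i hi
    ext s
    have := (hSV i hi).smul_eq_sum x.unop s
    simpa using this
  have : ∀ i ∈ T, a i * e (LinearMap.trace k (S i).obj (Algebra.lsmul k k (S i).obj x)) =
      ∑ γ ∈ (x.unop.1 V).coeff.support, e ((x.unop.1 V).coeff γ) *
        (a i * e (LinearMap.trace k (S i).obj (actionEnd (S i).obj γ.out))) := by
    intro i hi
    rw [hlin i hi, map_sum, map_sum, Finset.mul_sum]
    refine Finset.sum_congr rfl fun γ _ => ?_
    rw [map_smul, smul_eq_mul, map_mul]
    ring
  rw [Finset.sum_congr rfl this, Finset.sum_comm]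
  refine Finset.sum_eq_zero fun γ _ => ?_
  rw [← Finset.mul_sum, hgrp, mul_zero]

theorem eq_zero_of_sum_trace_eq_zero (hG : IsVirtuallyProP p G) {κ : Type*} [Field κ] (e : k →+* κ)
    (T : Finset (SimpleClass G k)) (a : SimpleClass G k → κ)
    (h : ∀ g : Reg p G,
      ∑ i ∈ T, a i * e (LinearMap.trace k i.rep.obj (actionEnd i.rep.obj g.1)) = 0) :
    ∀ i ∈ T, a i = 0 := by
  classical
  intro i hi
  have := fun j : SimpleClass G k => finite_obj j.rep
  obtain ⟨x, hx, hx0⟩ := IsSimpleModule.exists_trace_ne_zero k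
    (fun j : T => j.1.rep.obj) (fun j j' hjj' => SimpleClass.isEmpty_equiv
      fun h => hjj' (Subtype.ext h)) ⟨i, hi⟩
  have hs := sum_trace_eq_zero hG e T SimpleClass.rep a h x
  rw [Finset.sum_eq_single i] at hs
  · refine (mul_eq_zero.1 hs).resolve_right ?_
    exact fun h0 => hx ((map_eq_zero e).1 h0)
  · intro j hj hji
    have : Algebra.lsmul k k j.rep.obj x = 0 := by
      ext s
      exact hx0 ⟨j, hj⟩ (fun h => hji (congrArg Subtype.val h)) s
    rw [this, map_zero, map_zero, mul_zero]
  · exact fun h => absurd hi h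

variable {k' : Type*} [Field k'] [Algebra k k'] {O : Type*} [CommRing O] [IsDomain O]
  {F : Type*} [Field F] [Algebra O F] (red : O →+* k') {ω : O}

/-- Evaluation of invariant functions at a `p`-regular element. -/
noncomputable def evalInvariant (g : Reg p G) : invariantFunctions p G k k' F →ₗ[F] F where
  toFun f := f.1 g
  map_add' _ _ := rfl
  map_smul' _ _ := rfl

theorem linearIndependent_brauerFunction (hred : Function.Surjective red)
    (hOF : Function.Injective (algebraMap O F)) (hG : IsVirtuallyProP p G)
    (hω : IsPrimitiveRoot ω (pPrimePart p G)) (hm : (pPrimePart p G : k') ≠ 0) :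
    LinearIndependent F fun s : SimpleClass G k =>
      brauerFunction (F := F) red hG hω hm s.rep := by
  rw [linearIndependent_iff']
  intro T c hc
  by_contra! hcon
  obtain ⟨i₁, hi₁, hci₁⟩ := hcon
  let A : Subring F := (algebraMap O F).range
  let θ : O ≃+* A := RingEquiv.ofBijective (algebraMap O F).rangeRestrict
    ⟨fun x y h => hOF (congrArg Subtype.val h), (algebraMap O F).rangeRestrict_surjective⟩
  let I : Ideal A := (RingHom.ker red).comap θ.symm
  have hI : I ≠ ⊤ := by
    rw [Ideal.ne_top_iff_one]
    intro h
    have : red (θ.symm 1) = 0 := h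
    simp at this
  -- A valuation ring of `F` that contains `O` and in which `ker red` consists of nonunits.
  obtain ⟨V, hAV, hIV⟩ := Ideal.image_subset_nonunits_valuationSubring I hI
  -- Dividing by a coefficient of maximal valuation puts all of them in `V`, with `i₀`-th
  -- coefficient `1`, which survives reduction.
  obtain ⟨i₀, hi₀, hmax⟩ := T.exists_max_image (fun i => V.valuation (c i)) ⟨i₁, hi₁⟩
  have hc₀ : c i₀ ≠ 0 := by
    intro h
    have := hmax i₁ hi₁
    rw [h, map_zero, le_zero_iff, map_eq_zero] at this
    exact hci₁ this
  have hdV : ∀ i, ∃ d : V, i ∈ T → (d : F) = c i / c i₀ := by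
    intro i
    by_cases hi : i ∈ T
    · refine ⟨⟨c i / c i₀, ?_⟩, fun _ => rfl⟩
      rw [← V.valuation_le_one_iff, map_div₀]
      exact div_le_one_of_le₀ (hmax i hi) zero_le
    · exact ⟨0, fun h => absurd h hi⟩
  choose d hd using hdV
  let η : O →+* V :=
    { toFun := fun z => ⟨algebraMap O F z, hAV ⟨z, rfl⟩⟩
      map_one' := Subtype.ext (map_one _)
      map_mul' := fun a b => Subtype.ext (map_mul _ a b)
      map_zero' := Subtype.ext (map_zero _)
      map_add' := fun a b => Subtype.ext (map_add _ a b) }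
  let res := (IsLocalRing.residue V).comp η
  have hker : ∀ z : O, z ∈ RingHom.ker red → z ∈ RingHom.ker res := by
    intro z hz
    have h1 : algebraMap O F z ∈ V.nonunits :=
      hIV ⟨θ z, by simpa [I] using hz, rfl⟩
    rw [RingHom.mem_ker]
    change IsLocalRing.residue V (η z) = 0
    rw [IsLocalRing.residue_eq_zero_iff]
    obtain ⟨h2, h3⟩ := ValuationSubring.mem_nonunits_iff_exists_mem_maximalIdeal.1 h1
    exact h3
  -- Since `red` is surjective and its kernel dies in the residue field of `V`, that field is an
  -- extension of `k'`.
  let ē : k' →+* IsLocalRing.ResidueField V :=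
    RingHom.liftOfSurjective red hred ⟨res, hker⟩
  have hē : ∀ z, ē (red z) = res z := fun z =>
    RingHom.liftOfRightInverse_comp_apply red _ (Function.rightInverse_surjInv hred) ⟨res, hker⟩ z
  have key := eq_zero_of_sum_trace_eq_zero hG (ē.comp (algebraMap k k')) T
    (fun i => IsLocalRing.residue V (d i)) ?_ i₀ hi₀
  · have h1 : d i₀ = 1 := Subtype.ext (by rw [hd i₀ hi₀, div_self hc₀]; rfl)
    simp [h1] at key
  · intro g
    choose b hb hbr using fun i : SimpleClass G k =>
      exists_algebraMap_eq_brauerCharacter (F := F) red hG hω hm i.rep g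
    have h1 : ∑ i ∈ T, d i * η (b i) = 0 := by
      apply Subtype.ext
      have h3 : ∑ i ∈ T, c i * brauerCharacter p F red i.rep g = 0 := by
        have h2 := congrArg (evalInvariant (k := k) (k' := k') (F := F) g) hc
        rw [map_sum, map_zero] at h2
        simp only [map_smul] at h2
        exact h2
      have h4 : ∑ i ∈ T, (d i : F) * algebraMap O F (b i) = 0 := by
        rw [← zero_div (c i₀), ← h3, Finset.sum_div]
        refine Finset.sum_congr rfl fun i hi => ?_
        rw [hd i hi, hb]
        ring
      simpa [η] using h4
    have h2 := congrArg (IsLocalRing.residue V) h1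
    rw [map_sum, map_zero] at h2
    rw [← h2]
    refine Finset.sum_congr rfl fun i _ => ?_
    rw [RingHom.comp_apply, ← hbr, hē, map_mul]
    rfl

theorem brauerLinear_injective (hred : Function.Surjective red)
    (hOF : Function.Injective (algebraMap O F)) (hG : IsVirtuallyProP p G)
    (hω : IsPrimitiveRoot ω (pPrimePart p G)) (hm : (pPrimePart p G : k') ≠ 0) :
    Function.Injective (brauerLinear (k := k) (F := F) red hG hω hm) := by
  have hspan : ∀ x : F ⊗[ℤ] K0 (finiteDimTopModules k G),
      x ∈ Submodule.span F (Set.range fun s : SimpleClass G k => (1 : F) ⊗ₜ[ℤ] K0.mk s.rep) := by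
    intro x
    induction x with
    | zero => exact zero_mem _
    | add x y hx hy => exact add_mem hx hy
    | tmul c y =>
      have hy : y ∈ AddSubgroup.closure (Set.range fun s : SimpleClass G k => K0.mk s.rep) := by
        rw [K0.closure_simple_eq_top]
        trivial
      induction hy using AddSubgroup.closure_induction with
      | mem y hy =>
        obtain ⟨s, rfl⟩ := hy
        have : c ⊗ₜ[ℤ] K0.mk s.rep = c • ((1 : F) ⊗ₜ[ℤ] K0.mk s.rep) := by
          rw [TensorProduct.smul_tmul', smul_eq_mul, mul_one]
        rw [this]
        exact Submodule.smul_mem _ _ (Submodule.subset_span ⟨s, rfl⟩)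
      | zero => rw [TensorProduct.tmul_zero]; exact zero_mem _
      | add y z _ _ hy hz => rw [TensorProduct.tmul_add]; exact add_mem hy hz
      | neg y _ hy => rw [TensorProduct.tmul_neg]; exact neg_mem hy
  rw [injective_iff_map_eq_zero]
  intro x hx
  obtain ⟨c, rfl⟩ := (Finsupp.mem_span_range_iff_exists_finsupp).1 (hspan x)
  have hc : Finsupp.linearCombination F (fun s : SimpleClass G k =>
      brauerFunction (F := F) red hG hω hm s.rep) c = 0 := by
    rw [← hx, Finsupp.sum, map_sum, Finsupp.linearCombination_apply, Finsupp.sum]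
    refine Finset.sum_congr rfl fun s _ => ?_
    rw [map_smul, brauerLinear_tmul_mk, one_smul]
  have := linearIndependent_iff.1 (linearIndependent_brauerFunction (k := k) red hred hOF hG hω hm) c hc
  simp [this]

end Injectivity

end BermanWitt

/-! ### Matrices of finite order over `O` and characters of cyclic groups. -/

/-- Over the fraction field the eigenvalues are powers of `ω`, so they already lie in `O`. -/
theorem Matrix.exists_charpoly_pow_eq {O n : Type*} [CommRing O] [IsDomain O] [Fintype n]
    [DecidableEq n] {m : ℕ} (hm : m ≠ 0) {ω : O} (hω : IsPrimitiveRoot ω m) (M : Matrix n n O)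
    (hM : M ^ m = 1) : ∃ s : Multiset O, (∀ z ∈ s, z ^ m = 1) ∧ ∀ t : ℕ,
      (M ^ t).charpoly = (s.map fun z => X - C (z ^ t)).prod ∧
      (M ^ t).trace = (s.map fun z => z ^ t).sum := by
  have : NeZero m := ⟨hm⟩
  let K := FractionRing O
  have hinj : Function.Injective (algebraMap O K) := IsFractionRing.injective O K
  have hωK : IsPrimitiveRoot (algebraMap O K ω) m := hω.map_of_injective hinj
  let T : Module.End K (n → K) := Matrix.toLin' (M.map (algebraMap O K))
  have hTpow : ∀ t : ℕ, T ^ t = Matrix.toLin' ((M ^ t).map (algebraMap O K)) := by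
    intro t
    rw [← Matrix.toLin'_pow]
    congr 1
    exact (map_pow (algebraMap O K).mapMatrix M t).symm
  obtain ⟨s, hs, hst⟩ := LinearMap.exists_charpoly_pow_eq hm (X_pow_sub_one_splits hωK) _ T rfl (by
    rw [hTpow, hM, Matrix.map_one _ (map_zero _) (map_one _), Matrix.toLin'_one]
    rfl)
  have hlift : ∀ ξ : K, ∃ z : O, ξ ^ m = 1 → z ^ m = 1 ∧ algebraMap O K z = ξ := by
    intro ξ
    by_cases h : ξ ^ m = 1
    · obtain ⟨i, -, hi⟩ := hωK.eq_pow_of_pow_eq_one h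
      refine ⟨ω ^ i, fun _ => ⟨?_, by rw [map_pow, hi]⟩⟩
      rw [← pow_mul, mul_comm, pow_mul, hω.pow_eq_one, one_pow]
    · exact ⟨0, fun h' => absurd h' h⟩
  choose l hl using hlift
  have hchar : ∀ t : ℕ, (M ^ t).charpoly = ((s.map l).map fun z => X - C (z ^ t)).prod := by
    intro t
    apply Polynomial.map_injective _ hinj
    have := hst t
    rw [hTpow, ← Matrix.charpoly_map, ← LinearMap.charpoly_toMatrix _ (Pi.basisFun K n)] at *
    rw [LinearMap.toMatrix_eq_toMatrix', LinearMap.toMatrix'_toLin'] at this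
    rw [this, Polynomial.map_multiset_prod, Multiset.map_map, Multiset.map_map]
    congr 1
    refine Multiset.map_congr rfl fun ξ hξ => ?_
    simp [(hl ξ (hs ξ hξ)).2]
  refine ⟨s.map l, ?_, fun t => ⟨hchar t, ?_⟩⟩
  · intro z hz
    obtain ⟨ξ, hξ, rfl⟩ := Multiset.mem_map.1 hz
    exact (hl ξ (hs ξ hξ)).1
  · have h1 : (M ^ t).charpoly = (((s.map l).map fun z => z ^ t).map fun z => X - C z).prod := by
      rw [hchar, Multiset.map_map (fun z => X - C z)]
      rfl
    rw [Matrix.trace_eq_sum_roots_charpoly_of_splits, h1, roots_multiset_prod_X_sub_C]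
    rw [h1]
    refine Polynomial.Splits.multisetProd fun f hf => ?_
    obtain ⟨a, -, rfl⟩ := Multiset.mem_map.1 hf
    exact Polynomial.Splits.X_sub_C a

section CyclicCharacter

variable {Γ O : Type*} [Group Γ] [CommRing O] [IsDomain O] {c : Γ} {ζ : O}

/-- The `j`-th power of the character of the cyclic group generated by `c` that maps `c` to `ζ`. -/
theorem exists_cyclicCharacter (hc : orderOf c ≠ 0) (hζ : IsPrimitiveRoot ζ (orderOf c)) (j : ℕ) :
    ∃ χ : Subgroup.zpowers c →* O, ∀ (l : ℕ) (h : c ^ l ∈ Subgroup.zpowers c),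
      χ ⟨c ^ l, h⟩ = ζ ^ (j * l) := by
  let u : Oˣ := (hζ.isUnit hc).unit
  have hu : (u : O) = ζ := rfl
  have hg : ∀ x, x ∈ Subgroup.zpowers (⟨c, Subgroup.mem_zpowers c⟩ : Subgroup.zpowers c) := by
    rintro ⟨x, hx⟩
    obtain ⟨i, rfl⟩ := Subgroup.mem_zpowers_iff.1 hx
    exact Subgroup.mem_zpowers_iff.2 ⟨i, Subtype.ext (by simp)⟩
  have ho : orderOf (u ^ j) ∣ orderOf (⟨c, Subgroup.mem_zpowers c⟩ : Subgroup.zpowers c) := by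
    rw [Subgroup.orderOf_mk, orderOf_dvd_iff_pow_eq_one]
    ext
    rw [Units.val_pow_eq_pow_val, Units.val_pow_eq_pow_val, hu, ← pow_mul, mul_comm, pow_mul,
      hζ.pow_eq_one, one_pow, Units.val_one]
  refine ⟨(Units.coeHom O).comp (monoidHomOfForallMemZpowers hg ho), fun l h => ?_⟩
  have h1 : (⟨c ^ l, h⟩ : Subgroup.zpowers c) = ⟨c, Subgroup.mem_zpowers c⟩ ^ l := rfl
  rw [h1, map_pow, MonoidHom.comp_apply, monoidHomOfForallMemZpowers_apply_gen, pow_mul]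
  simp [hu]

/-- Fourier inversion on a finite cyclic group, at the generator. -/
theorem sum_cyclicCharacter_extendZero [DecidableEq Γ] (hc : orderOf c ≠ 0)
    (hζ : IsPrimitiveRoot ζ (orderOf c)) (χ : ℕ → Subgroup.zpowers c →* O)
    (hχ : ∀ (j l : ℕ) (h : c ^ l ∈ Subgroup.zpowers c), χ j ⟨c ^ l, h⟩ = ζ ^ (j * l)) (y : Γ) :
    ∑ j ∈ Finset.range (orderOf c), ζ ^ ((orderOf c - 1) * j) * (χ j).extendZero _ y =
      if y = c then (orderOf c : O) else 0 := by
  by_cases hy : y ∈ Subgroup.zpowers c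
  · have hfin : IsOfFinOrder c := orderOf_pos_iff.1 (Nat.pos_of_ne_zero hc)
    obtain ⟨l, rfl⟩ := hfin.mem_powers_iff_mem_zpowers.2 hy
    change ∑ j ∈ Finset.range (orderOf c), ζ ^ ((orderOf c - 1) * j) *
      (χ j).extendZero _ (c ^ l) = if c ^ l = c then (orderOf c : O) else 0
    -- The exponent `(orderOf c - 1) * j` stands for `-j`, which leaves a geometric sum in `ζ ^ (l -
    -- 1)`.
    have hterm : ∀ j, ζ ^ ((orderOf c - 1) * j) * (χ j).extendZero _ (c ^ l) =
        (ζ ^ (orderOf c - 1 + l)) ^ j := by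
      intro j
      rw [MonoidHom.extendZero_of_mem _ _ hy, hχ, ← pow_add, ← pow_mul]
      congr 1
      ring
    rw [Finset.sum_congr rfl fun j _ => hterm j]
    have hiff : c ^ l = c ↔ ζ ^ (orderOf c - 1 + l) = 1 := by
      rw [hζ.pow_eq_one_iff_dvd, orderOf_dvd_iff_pow_eq_one, pow_add]
      have : c ^ (orderOf c - 1) = c⁻¹ := by
        rw [eq_inv_iff_mul_eq_one, ← pow_succ, Nat.sub_add_cancel (Nat.pos_of_ne_zero hc),
          pow_orderOf_eq_one]
      rw [this, inv_mul_eq_one, eq_comm]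
    split_ifs with h
    · rw [hiff.1 h]
      simp
    · have h1 : ζ ^ (orderOf c - 1 + l) - 1 ≠ 0 := sub_ne_zero.2 fun h' => h (hiff.2 h')
      refine (mul_eq_zero.1 ?_).resolve_left h1
      rw [mul_geom_sum, ← pow_mul, mul_comm, pow_mul, hζ.pow_eq_one, one_pow, sub_self]
  · have hyc : y ≠ c := by
      rintro rfl
      exact hy (Subgroup.mem_zpowers y)
    rw [if_neg hyc]
    refine Finset.sum_eq_zero fun j _ => ?_
    rw [MonoidHom.extendZero_of_notMem _ _ hy, mul_zero]

end CyclicCharacter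

namespace BermanWitt

universe u v w

/-! ### Objects of the category from matrix representations. -/

section MatrixModule

variable {k : Type u} [Field k] {G : Type v} [Group G] [TopologicalSpace G]
  {U : OpenNormalSubgroup G} {ι : Type v} [Fintype ι] [DecidableEq ι]

/-- The right `k[[G]]`-module of a matrix representation of `G/U`. -/
def MatrixModule (_ : G ⧸ U.toSubgroup →* Matrix ι ι k) : Type max u v := ι → k

variable (ρ : G ⧸ U.toSubgroup →* Matrix ι ι k)

instance : AddCommGroup (MatrixModule ρ) := inferInstanceAs (AddCommGroup (ι → k))

/-- The action of `k[[G]]` on row vectors through a matrix representation of `G/U`. -/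
noncomputable def matrixAction : (completedGroupAlgebra k G)ᵐᵒᵖ →+* Module.End k (ι → k) where
  -- Transposing gives right multiplication on row vectors, matching the opposite ring.
  toFun x := Matrix.toLin' ((MonoidAlgebra.lift k _ _ ρ (x.unop.1 U)).transpose)
  map_one' := by
    simp
    rfl
  map_zero' := by simp
  map_add' x y := by simp
  map_mul' x y := by simp [Matrix.toLin'_mul]; rfl

noncomputable instance : Module (completedGroupAlgebra k G)ᵐᵒᵖ (MatrixModule ρ) :=
  Module.compHom (ι → k) (matrixAction ρ)

/-- The module of a matrix representation, as an object of the category of right modules. -/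
noncomputable def matrixObj : RightModules k G :=
  ModuleCat.of (completedGroupAlgebra k G)ᵐᵒᵖ (MatrixModule ρ)

/-- The identity map from row vectors to the module of a matrix representation. -/
noncomputable def matrixObjEquiv : (ι → k) ≃ₗ[k] matrixObj ρ where
  toFun a := a
  invFun a := a
  left_inv _ := rfl
  right_inv _ := rfl
  map_add' _ _ := rfl
  map_smul' r a := by
    change r • a = matrixAction ρ (algebraMap k _ r) a
    simp [matrixAction, Algebra.algebraMap_eq_smul_one]

theorem charpoly_actionEnd_matrixObj (g : G) [Module.Finite k (matrixObj ρ)] :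
    (actionEnd (matrixObj ρ) g).charpoly = (ρ g).charpoly := by
  have h : actionEnd (matrixObj ρ) g =
      (matrixObjEquiv ρ).conj (Matrix.toLin' (ρ g).transpose) := by
    ext a
    change matrixAction ρ (MulOpposite.op (groupElement k g)) a = Matrix.toLin' (ρ g).transpose a
    simp [matrixAction, groupElement]
  rw [h, LinearEquiv.charpoly_conj, Matrix.charpoly_toLin', Matrix.charpoly_transpose]

theorem actsThrough_matrixObj : ActsThrough (matrixObj ρ) U := by
  intro x hx a
  change matrixAction ρ (MulOpposite.op x) a = 0
  simp only [matrixAction, RingHom.coe_mk, MonoidHom.coe_mk, OneHom.coe_mk, MulOpposite.unop_op, hx,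
    map_zero, Matrix.transpose_zero]
  rfl

theorem exists_object_of_matrix [IsTopologicalGroup G] [CompactSpace G]
    [TotallyDisconnectedSpace G] [Finite k] {n : Type*} [Fintype n] [DecidableEq n]
    (ρ : G ⧸ U.toSubgroup →* Matrix n n k) :
    ∃ A : (finiteDimTopModules k G).FullSubcategory, ∀ (g : G) [Module.Finite k A.obj],
      (actionEnd A.obj g).charpoly = (ρ g).charpoly := by
  -- Reindexing moves the representation into the universe of the category.
  let E : n ≃ ULift.{v} (Fin (Fintype.card n)) := (Fintype.equivFin n).trans Equiv.ulift.symm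
  let ρ' : G ⧸ U.toSubgroup →* Matrix (ULift.{v} (Fin (Fintype.card n))) _ k :=
    (Matrix.reindexAlgEquiv k k E).toMulEquiv.toMonoidHom.comp ρ
  have hfin : Finite (matrixObj ρ') :=
    inferInstanceAs (Finite (ULift.{v} (Fin (Fintype.card n)) → k))
  refine ⟨⟨matrixObj ρ', finiteDimTopModules_of_actsThrough _ (actsThrough_matrixObj ρ')⟩,
    fun g _ => ?_⟩
  rw [charpoly_actionEnd_matrixObj]
  exact Matrix.charpoly_reindex E (ρ g)

end MatrixModule

end BermanWitt

namespace BermanWitt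

universe u v w

/-! ### Surjectivity by Fourier inversion on cyclic subgroups. -/

section Surjectivity

variable {p : ℕ} [Fact p.Prime] {G : Type v} [Group G] [TopologicalSpace G] [IsTopologicalGroup G]
  [CompactSpace G] [TotallyDisconnectedSpace G] {k : Type u} [Field k] [Finite k]
  {k' : Type*} [Field k'] [Algebra k k'] [FiniteDimensional k k'] [IsGalois k k']
  {O : Type*} [CommRing O] [IsDomain O]
  {F : Type*} [Field F] [Algebra O F] (red : O →+* k') {ω : O}

/-- The Brauer character of the restriction of scalars to `k` of the reduction of a matrix
representation over `O`. -/
theorem exists_brauerCharacter_eq_sum_trace (hG : IsVirtuallyProP p G)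
    (hω : IsPrimitiveRoot ω (pPrimePart p G)) (hm : (pPrimePart p G : k') ≠ 0)
    [Fintype (k' ≃ₐ[k] k')] (t : (k' ≃ₐ[k] k') → ℕ)
    (ht : ∀ (σ : k' ≃ₐ[k] k') (ζ : k'), ζ ^ pPrimePart p G = 1 → σ ζ = ζ ^ t σ)
    {U : OpenNormalSubgroup G} {n : Type*} [Fintype n] [DecidableEq n]
    (N : G ⧸ U.toSubgroup →* Matrix n n O) :
    ∃ A : (finiteDimTopModules k G).FullSubcategory, ∀ g : Reg p G,
      brauerCharacter p F red A g =
        ∑ σ, algebraMap O F (N ((g.1 : G ⧸ U.toSubgroup) ^ t σ)).trace := by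
  classical
  let b : Module.Basis (k' ≃ₐ[k] k') k k' := (Module.finBasis k k').reindex
    (Fintype.equivOfCardEq (by
      rw [Fintype.card_fin, ← IsGalois.card_aut_eq_finrank, Nat.card_eq_fintype_card]))
  let L : k' →+* Matrix (k' ≃ₐ[k] k') (k' ≃ₐ[k] k') k := (Algebra.leftMulMatrix b).toRingHom
  -- Restriction of scalars in matrix form: each entry, reduced to `k'`, becomes its multiplication
  -- matrix over `k`.
  let ρ : G ⧸ U.toSubgroup →* Matrix (n × (k' ≃ₐ[k] k')) (n × (k' ≃ₐ[k] k')) k :=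
    (((Matrix.compRingEquiv n (k' ≃ₐ[k] k') k).toRingHom.comp
      (L.mapMatrix.comp red.mapMatrix)).toMonoidHom).comp N
  obtain ⟨A, hA⟩ := exists_object_of_matrix ρ
  refine ⟨A, fun g => ?_⟩
  have hfin := moduleFinite_obj A
  obtain ⟨s, hs, hst⟩ := Matrix.exists_charpoly_pow_eq (pPrimePart_pos hG).ne' hω
    (N (g.1 : G ⧸ U.toSubgroup)) (by rw [← map_pow, Reg.mk_pow_eq_one hG, map_one])
  have h1 : (red.mapMatrix (N (g.1 : G ⧸ U.toSubgroup))).charpoly =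
      ((s.map red).map fun z => X - C z).prod := by
    have := (hst 1).1
    rw [pow_one] at this
    rw [RingHom.mapMatrix_apply, Matrix.charpoly_map, this, Polynomial.map_multiset_prod,
      Multiset.map_map, Multiset.map_map]
    simp
  have h2 := Matrix.charpoly_comp_map L _ _ h1
  -- Each eigenvalue `red z` contributes all its conjugates `σ (red z) = red (z ^ t σ)`.
  have h3 : (actionEnd A.obj g.1).charpoly.map (algebraMap k k') =
      ((Finset.univ.val.bind fun σ => s.map fun z => z ^ t σ).map fun z => X - C (red z)).prod := by
    rw [hA]
    change (((red.mapMatrix (N (g.1 : G ⧸ U.toSubgroup))).map L).comp n n _ _ k).charpoly.map _ = _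
    rw [h2, Polynomial.map_multiset_prod, Multiset.map_map, Multiset.map_map, Multiset.map_bind,
      Multiset.prod_bind]
    have h4 : ∀ z ∈ s, ((Polynomial.map (algebraMap k k') ∘ fun z => (L z).charpoly) ∘ red) z =
        (Finset.univ.val.map fun σ => X - C (red (z ^ t σ))).prod := by
      intro z hz
      have := Algebra.charpoly_leftMulMatrix_map_eq_prod b (red z)
      refine this.trans (Finset.prod_congr rfl fun σ _ => ?_)
      rw [ht σ (red z) (by rw [← map_pow, hs z hz, map_one]), ← map_pow red]
    rw [Multiset.map_congr rfl h4, Multiset.prod_map_prod_map]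
    simp only [Multiset.map_map]
    rfl
  rw [brauerCharacter_eq_sum (F := F) red hω hm A g _ h3, Multiset.map_bind, Multiset.sum_bind]
  · refine Finset.sum_congr rfl fun σ _ => ?_
    rw [map_pow, (hst (t σ)).2, map_multiset_sum]
  · intro z hz
    obtain ⟨σ, -, hz⟩ := Multiset.mem_bind.1 hz
    obtain ⟨y, hy, rfl⟩ := Multiset.mem_map.1 hz
    rw [← pow_mul, mul_comm, pow_mul, hs y hy, one_pow]

open Classical in
/-- A combination of Brauer characters that counts how often conjugates of powers of `g` hit a
given `p`-regular class of a finite quotient. -/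
theorem exists_brauerLinear_eq_sum_ite (hG : IsVirtuallyProP p G)
    (hω : IsPrimitiveRoot ω (pPrimePart p G)) (hm : (pPrimePart p G : k') ≠ 0)
    [Fintype (k' ≃ₐ[k] k')] (t : (k' ≃ₐ[k] k') → ℕ)
    (ht : ∀ (σ : k' ≃ₐ[k] k') (ζ : k'), ζ ^ pPrimePart p G = 1 → σ ζ = ζ ^ t σ)
    (U : OpenNormalSubgroup G) [Fintype (G ⧸ U.toSubgroup)] (c : G ⧸ U.toSubgroup)
    (hc : c ^ pPrimePart p G = 1) :
    ∃ y : F ⊗[ℤ] K0 (finiteDimTopModules k G), ∀ g : Reg p G,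
      (brauerLinear red hG hω hm y).1 g = ∑ σ : k' ≃ₐ[k] k', ∑ x : G ⧸ U.toSubgroup,
        if x⁻¹ * (g.1 : G ⧸ U.toSubgroup) ^ t σ * x = c then (1 : F) else 0 := by
  have hdvd : orderOf c ∣ pPrimePart p G := orderOf_dvd_iff_pow_eq_one.2 hc
  have hm0 : pPrimePart p G ≠ 0 := (pPrimePart_pos hG).ne'
  have hc0 : orderOf c ≠ 0 := fun h => hm0 (Nat.eq_zero_of_zero_dvd (h ▸ hdvd))
  obtain ⟨ζ, hζ⟩ : ∃ ζ : O, IsPrimitiveRoot ζ (orderOf c) := by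
    obtain ⟨d, hd⟩ := hdvd
    exact ⟨ω ^ d, hω.pow (pPrimePart_pos hG) (by rw [hd, mul_comm])⟩
  choose χ hχ using fun j : ℕ => exists_cyclicCharacter hc0 hζ j
  choose A hA using fun j : ℕ => exists_brauerCharacter_eq_sum_trace (k := k) (F := F) red hG hω hm t ht
    ((χ j).inducedMatrix _)
  refine ⟨∑ j ∈ Finset.range (orderOf c),
    algebraMap O F (ζ ^ ((orderOf c - 1) * j)) ⊗ₜ[ℤ] K0.mk (A j), fun g => ?_⟩
  change evalInvariant g (brauerLinear red hG hω hm _) = _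
  simp only [map_sum, brauerLinear_tmul_mk, map_smul, smul_eq_mul]
  change ∑ j ∈ Finset.range (orderOf c), algebraMap O F (ζ ^ ((orderOf c - 1) * j)) *
    brauerCharacter p F red (A j) g = _
  simp only [hA, MonoidHom.trace_inducedMatrix, Finset.mul_sum]
  rw [Finset.sum_comm]
  refine Finset.sum_congr rfl fun σ _ => ?_
  -- The indicator of `x⁻¹ g ^ t_σ x = c` is unchanged when `x` is multiplied on the right by an
  -- element of `⟨c⟩`; the factor `|⟨c⟩|` matches the one from Fourier inversion.
  have hsum := Subgroup.sum_quotient_out_conj (Subgroup.zpowers c)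
    (fun x : G ⧸ U.toSubgroup =>
      if x⁻¹ * (g.1 : G ⧸ U.toSubgroup) ^ t σ * x = c then (1 : F) else 0) (by
      intro x h hh
      have hcomm : h * c = c * h := by
        obtain ⟨i, rfl⟩ := Subgroup.mem_zpowers_iff.1 hh
        exact (Commute.refl c).zpow_left i
      refine if_congr ?_ rfl rfl
      have : (x * h)⁻¹ * (g.1 : G ⧸ U.toSubgroup) ^ t σ * (x * h) =
          h⁻¹ * (x⁻¹ * (g.1 : G ⧸ U.toSubgroup) ^ t σ * x) * h := by group
      rw [this, mul_assoc, inv_mul_eq_iff_eq_mul, hcomm, mul_left_inj])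
  rw [← hsum, Finset.smul_sum]
  simp only [← map_mul, map_sum, Finset.mul_sum]
  rw [Finset.sum_comm]
  refine Finset.sum_congr rfl fun i _ => ?_
  rw [← map_sum, sum_cyclicCharacter_extendZero hc0 hζ χ hχ, Nat.card_zpowers]
  split_ifs <;> simp

theorem brauerLinear_surjective [CharZero F] (hG : IsVirtuallyProP p G)
    (hω : IsPrimitiveRoot ω (pPrimePart p G)) (hm : (pPrimePart p G : k') ≠ 0) :
    Function.Surjective (brauerLinear (k := k) (F := F) red hG hω hm) := by
  classical
  have := Fintype.ofFinite (k' ≃ₐ[k] k')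
  have hm0 : NeZero (pPrimePart p G) := ⟨(pPrimePart_pos hG).ne'⟩
  have hωk := isPrimitiveRoot_red red hω hm
  have htex : ∀ σ : k' ≃ₐ[k] k', ∃ t : ℕ, ∀ ζ : k', ζ ^ pPrimePart p G = 1 → σ ζ = ζ ^ t := by
    intro σ
    obtain ⟨t, -, ht⟩ := hωk.eq_pow_of_pow_eq_one
      (ξ := σ (red ω)) (by rw [← map_pow, hωk.pow_eq_one, map_one])
    refine ⟨t, fun ζ hζ => ?_⟩
    obtain ⟨i, -, rfl⟩ := hωk.eq_pow_of_pow_eq_one hζ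
    rw [map_pow, ← ht, ← pow_mul, ← pow_mul, mul_comm]
  choose t ht using htex
  intro f
  obtain ⟨U, hU⟩ := exists_openNormalSubgroup_factor hG f.1
  have := Fintype.ofFinite (G ⧸ U.toSubgroup)
  choose y hy using fun c : {c : G ⧸ U.toSubgroup // c ^ pPrimePart p G = 1} =>
    exists_brauerLinear_eq_sum_ite (k := k) (F := F) red hG hω hm t ht U c.1 c.2
  choose r hr using fun c : {c : G ⧸ U.toSubgroup // c ^ pPrimePart p G = 1} =>
    exists_reg_mk_eq hG U c.1 c.2
  let D : F := (Fintype.card (k' ≃ₐ[k] k') : F) * (Fintype.card (G ⧸ U.toSubgroup) : F)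
  have hD : D ≠ 0 := mul_ne_zero (Nat.cast_ne_zero.2 Fintype.card_ne_zero)
    (Nat.cast_ne_zero.2 Fintype.card_ne_zero)
  refine ⟨D⁻¹ • ∑ c, f.1 (r c) • y c, Subtype.ext (LocallyConstant.ext fun g => ?_)⟩
  -- Exactly one `c` contributes, the image of `x⁻¹ g ^ t_σ x`, and there `f` takes the value `f g`
  -- by invariance.
  have hterm : ∀ (σ : k' ≃ₐ[k] k') (x : G ⧸ U.toSubgroup),
      (∑ c : {c : G ⧸ U.toSubgroup // c ^ pPrimePart p G = 1}, f.1 (r c) *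
        if x⁻¹ * (g.1 : G ⧸ U.toSubgroup) ^ t σ * x = c.1 then (1 : F) else 0) = f.1 g := by
    intro σ x
    obtain ⟨x, rfl⟩ := QuotientGroup.mk_surjective x
    let g' := Reg.powConj x⁻¹ (t σ) g
    have hg' : (g'.1 : G ⧸ U.toSubgroup) =
        (x : G ⧸ U.toSubgroup)⁻¹ * (g.1 : G ⧸ U.toSubgroup) ^ t σ * x := by
      simp [g', Reg.powConj]
    rw [← hg']
    rw [Finset.sum_eq_single ⟨(g'.1 : G ⧸ U.toSubgroup), Reg.mk_pow_eq_one hG U g'⟩]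
    · rw [if_pos rfl, mul_one, hU _ g' (hr _)]
      exact f.2 x⁻¹ σ (t σ) (ht σ) g
    · intro c _ hc
      rw [if_neg fun h => hc (Subtype.ext h.symm), mul_zero]
    · simp
  change evalInvariant g (brauerLinear red hG hω hm _) = f.1 g
  simp only [map_smul, map_sum, smul_eq_mul]
  have hyg : ∀ c, evalInvariant g (brauerLinear (k := k) (F := F) red hG hω hm (y c)) = _ :=
    fun c => hy c g
  simp only [hyg]
  suffices h : ∑ c, f.1 (r c) * ∑ σ : k' ≃ₐ[k] k', ∑ x : G ⧸ U.toSubgroup,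
      (if x⁻¹ * (g.1 : G ⧸ U.toSubgroup) ^ t σ * x = c.1 then (1 : F) else 0) = D * f.1 g by
    rw [h, inv_mul_cancel_left₀ hD]
  simp only [Finset.mul_sum]
  rw [Finset.sum_comm]
  have : ∀ σ : k' ≃ₐ[k] k', ∑ c : {c : G ⧸ U.toSubgroup // c ^ pPrimePart p G = 1},
      ∑ x : G ⧸ U.toSubgroup, f.1 (r c) *
        (if x⁻¹ * (g.1 : G ⧸ U.toSubgroup) ^ t σ * x = c.1 then (1 : F) else 0) =
      (Fintype.card (G ⧸ U.toSubgroup) : F) * f.1 g := by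
    intro σ
    rw [Finset.sum_comm, Finset.sum_congr rfl fun x _ => hterm σ x]
    simp
  rw [Finset.sum_congr rfl fun σ _ => this σ, Finset.sum_const, Finset.card_univ, nsmul_eq_mul,
    ← mul_assoc]

end Surjectivity

end BermanWitt
-- The isomorphism.
theorem mainTheorem6 {p : ℕ} [Fact p.Prime]
    -- `G` is a profinite group which is virtually pro-`p`
    {G : Type*} [Group G] [TopologicalSpace G] [IsTopologicalGroup G] [CompactSpace G]
    [TotallyDisconnectedSpace G] (hG : BermanWitt.IsVirtuallyProP p G)
    -- `k` is a finite field of characteristic `p`, and `k' = k(ω)`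
    {k : Type*} [Field k] [Finite k] [CharP k p]
    {k' : Type*} [Field k'] [Algebra k k']
    [IsCyclotomicExtension {BermanWitt.pPrimePart p G} k k']
    -- `K` is a finite unramified extension of `ℚ_p` with residue field `k`
    {K : Type*} [Field K] [Algebra ℚ_[p] K] [FiniteDimensional ℚ_[p] K]
    [Algebra ℤ_[p] K] [IsScalarTower ℤ_[p] ℚ_[p] K]
    [Algebra.FormallyUnramified ℤ_[p] (integralClosure ℤ_[p] K)]
    (redK : integralClosure ℤ_[p] K →+* k) (hredK : Function.Surjective redK)
    -- `F = K(ω̃)`, with residue field `k'`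
    {F : Type*} [Field F] [Algebra K F]
    [IsCyclotomicExtension {BermanWitt.pPrimePart p G} K F]
    (redF : integralClosure (integralClosure ℤ_[p] K) F →+* k')
    (hredF : Function.Surjective redF)
    (hred : ∀ a : integralClosure ℤ_[p] K,
      redF (algebraMap _ _ a) = algebraMap k k' (redK a)) :
    ∃ Φ : F ⊗[ℤ] BermanWitt.K0 (BermanWitt.finiteDimTopModules k G) ≃ₗ[F]
        BermanWitt.invariantFunctions p G k k' F,
      ∀ (c : F) (A : (BermanWitt.finiteDimTopModules k G).FullSubcategory)
        (g : BermanWitt.Reg p G),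
        (Φ (c ⊗ₜ[ℤ] BermanWitt.K0.mk A)).1 g = c * BermanWitt.brauerCharacter p F redF A g := by
  have hm0 : NeZero (BermanWitt.pPrimePart p G) := ⟨(BermanWitt.pPrimePart_pos hG).ne'⟩
  have : CharZero K := charZero_of_injective_algebraMap (algebraMap ℚ_[p] K).injective
  have : CharZero F := charZero_of_injective_algebraMap (algebraMap K F).injective
  have : CharP k' p := charP_of_injective_algebraMap (algebraMap k k').injective p
  have hm : (BermanWitt.pPrimePart p G : k') ≠ 0 := by
    rw [Ne, CharP.cast_eq_zero_iff k' p, ← (Fact.out : p.Prime).coprime_iff_not_dvd]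
    exact BermanWitt.coprime_pPrimePart hG
  have : FiniteDimensional k k' :=
    IsCyclotomicExtension.finiteDimensional {BermanWitt.pPrimePart p G} k k'
  have : IsGalois k k' := IsCyclotomicExtension.isGalois {BermanWitt.pPrimePart p G} k k'
  obtain ⟨ω, hω⟩ := IsCyclotomicExtension.exists_isPrimitiveRoot K F
    (Set.mem_singleton (BermanWitt.pPrimePart p G)) hm0.out
  -- Roots of unity are integral, so the primitive root of `F` lies in the ring on which `redF` is
  -- defined.
  have hint : IsIntegral (integralClosure ℤ_[p] K) ω :=
    IsIntegral.of_pow (BermanWitt.pPrimePart_pos hG) (by rw [hω.pow_eq_one]; exact isIntegral_one)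
  have hinj : Function.Injective
      (algebraMap (integralClosure (integralClosure ℤ_[p] K) F) F) := Subtype.val_injective
  have hωO : IsPrimitiveRoot (⟨ω, (mem_integralClosure_iff _ _).2 hint⟩ : integralClosure (integralClosure ℤ_[p] K) F)
      (BermanWitt.pPrimePart p G) := IsPrimitiveRoot.of_map_of_injective hω hinj
  refine ⟨LinearEquiv.ofBijective (BermanWitt.brauerLinear redF hG hωO hm)
    ⟨BermanWitt.brauerLinear_injective redF hredF hinj hG hωO hm,
      BermanWitt.brauerLinear_surjective redF hG hωO hm⟩, fun c A g => ?_⟩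
  exact congrArg (fun f : BermanWitt.invariantFunctions p G k k' F => f.1 g)
    (BermanWitt.brauerLinear_tmul_mk redF hG hωO hm c A)
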